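/- Conventions. Signatures are (countable) first-order signatures with equality; two signatures are disjoint if $=$ is the only symbol they share. Interpretations have a non-empty domain and assign values to a countably infinite set of variables. A theory $\mathcal T$ is given by a set of sentences $\mathrm{Ax}(\mathcal T)$ (not necessarily computable), and a $\mathcal T$-interpretation is an interpretation that satisfies $\mathrm{Ax}(\mathcal T)$. A formula is $\mathcal T$-satisfiable if some $\mathcal T$-interpretation satisfies it. $\mathcal T$ is decidable if the set of (Gödel numbers of) $\mathcal T$-satisfiable quantifier-free formulas is decidable. $\mathcal T$ is smooth if for every quantifier-free formula $\varphi$, every $\mathcal T$-interpretation $\mathcal A$ that satisfies $\varphi$, and every cardinal $\kappa$ larger than the cardinality of the domain of $\mathcal A$, there is a $\mathcal T$-interpretation with a domain of cardinality $\kappa$ that satisfies $\varphi$. For theories $\mathcal T_1,\mathcal T_2$ over $\Sigma_1,\Sigma_2$, $\mathcal T_1\oplus\mathcal T_2$ is the theory over $\Sigma_1\cup\Sigma_2$ axiomatized by $\mathrm{Ax}(\mathcal T_1)\cup\mathrm{Ax}(\mathcal T_2)$. Let $\mathcal T_=$ be the theory over the signature with $0$-ary predicate symbols $P_1,P_2,\dots$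 (and no function symbols) axiomatized by $P_n\to\psi_{=n}$ for $n\ge 1$, where $\psi_{=n}$ says that the domain has exactly $n$ elements. For a function $f:\{1,2,\dots\}\to\{0,1\}$ and $i\in\{0,1\}$, let $f_i(k)=|\{1\le j\le k: f(j)=i\}|$. Call $f$ admissible if it is not computable, $f(1)=1$, and $f_0(2^k)=f_1(2^k)$ for all $k\ge 1$. Let $\mathcal T_f$ be the theory over the signature with one unary function symbol $s$ (and no predicate symbols) axiomatized, for all $k\ge1$, by $$\bigl[\psi^{=}_{\ge f_1(k)}\wedge\psi^{\ne}_{\ge f_0(k)}\bigr]\vee\bigvee_{i=1}^{k}\bigl[\psi^{=}_{=f_1(i)}\wedge\psi^{\ne}_{=f_0(i)}\bigr],$$ where $\psi^{=}_{\ge n}$ and $\psi^{=}_{=n}$ say that at least, respectively exactly, $n$ elements $x$ satisfy $s(x)=x$, and $\psi^{\ne}_{\ge n}$ and $\psi^{\ne}_{=n}$ say the same of $\neg(s(x)=x)$. Theorem. There are decidable theories $\mathcal T_1$ and $\mathcal T_2$ over disjoint signatures such that $\mathcal T_2$ is smooth but $\mathcal T_1\oplus\mathcal T_2$ is undecidable.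 (So two decidable theories over disjoint signatures need not have a decidable combination when the second is only assumed to be smooth.) More precisely, admissible functions exist, and for every admissible $f$, the theories $\mathcal T_1=\mathcal T_=$ and $\mathcal T_2=\mathcal T_f$ have these properties: their signatures are disjoint, $\mathcal T_=$ and $\mathcal T_f$ are decidable, $\mathcal T_f$ is smooth, and $\mathcal T_=\oplus\mathcal T_f$ is undecidable. -/

import Mathlib

open FirstOrder Cardinal

universe u

namespace TheoryCombination

/-! ### Signatures -/

/-- A first-order signature with equality (equality is a logical symbol and is not listed).
Symbols are named by natural numbers: `funcs n` and `preds n` are the sets of (names of) function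
symbols and predicate symbols of arity `n`. -/
structure Signature where
  funcs : ℕ → Set ℕ
  preds : ℕ → Set ℕ

namespace Signature

/-- The signature as a first-order language. -/
abbrev lang (S : Signature) : FirstOrder.Language.{0, 0} where
  Functions n := S.funcs n
  Relations n := S.preds n

/-- Two signatures are disjoint if they share no symbol other than equality. -/
def IsDisjoint (S₁ S₂ : Signature) : Prop :=
  ∀ n, S₁.funcs n ∩ S₂.funcs n = ∅ ∧ S₁.preds n ∩ S₂.preds n = ∅

/-- The signature with the symbols of both signatures. -/
def union (S₁ S₂ : Signature) : Signature where
  funcs n := S₁.funcs n ∪ S₂.funcs n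
  preds n := S₁.preds n ∪ S₂.preds n

/-- Inclusion of the first signature in the union. -/
def inclLeft (S₁ S₂ : Signature) : S₁.lang →ᴸ (S₁.union S₂).lang where
  onFunction _ f := ⟨f.1, Or.inl f.2⟩
  onRelation _ R := ⟨R.1, Or.inl R.2⟩

/-- Inclusion of the second signature in the union. -/
def inclRight (S₁ S₂ : Signature) : S₂.lang →ᴸ (S₁.union S₂).lang where
  onFunction _ f := ⟨f.1, Or.inr f.2⟩
  onRelation _ R := ⟨R.1, Or.inr R.2⟩

end Signature

/-- `T₁ ⊕ T₂`: the theory over the union of the signatures which is axiomatized by the union of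
the axiomatizations of `T₁` and `T₂`. -/
def combination {S₁ S₂ : Signature} (T₁ : S₁.lang.Theory) (T₂ : S₂.lang.Theory) :
    (S₁.union S₂).lang.Theory :=
  (S₁.inclLeft S₂).onTheory T₁ ∪ (S₁.inclRight S₂).onTheory T₂

/-! ### Satisfiability and smoothness

Formulas have variables indexed by `ℕ`. An interpretation is a domain `A` with an
`S.lang`-structure and a valuation `v : ℕ → A` of the variables (so that `A` is non-empty). -/

/-- Some interpretation that is a model of `T` satisfies `φ`. -/
def IsSat {S : Signature} (T : S.lang.Theory) (φ : S.lang.Formula ℕ) : Prop :=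
  ∃ (A : Type u) (_ : S.lang.Structure A) (v : ℕ → A), A ⊨ T ∧ φ.Realize v

/-- `T` is smooth: whenever an interpretation `A` of `T` satisfies a quantifier-free formula `φ`
and `κ` is a cardinal larger than that of `A`, some interpretation `B` of `T` of cardinality `κ`
satisfies `φ`. -/
def IsSmooth {S : Signature} (T : S.lang.Theory) : Prop :=
  ∀ φ : S.lang.Formula ℕ, φ.IsQF →
    ∀ (A : Type u) (_ : S.lang.Structure A) (v : ℕ → A), A ⊨ T → φ.Realize v →
      ∀ κ : Cardinal.{u}, #A < κ →
        ∃ (B : Type u) (_ : S.lang.Structure B) (w : ℕ → B),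
          #B = κ ∧ B ⊨ T ∧ φ.Realize w

/-! ### Gödel numbers and decidability -/

/-- The Gödel number of a term, given numbers for its variables. -/
def termCode {S : Signature} {α : Type} (c : α → ℕ) : S.lang.Term α → ℕ
  | .var a => 2 * c a
  | .func (l := n) f ts =>
      2 * Nat.pair n (Nat.pair f.1
        (Encodable.encode (List.ofFn fun i => termCode c (ts i)))) + 1

/-- The number of a variable of a formula, free or bound. -/
def varCode {n : ℕ} : ℕ ⊕ Fin n → ℕ
  | .inl x => 2 * x
  | .inr i => 2 * (i : ℕ) + 1

/-- The Gödel number of a formula. -/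
def formulaCode {S : Signature} : {n : ℕ} → S.lang.BoundedFormula ℕ n → ℕ
  | _, .falsum => 0
  | _, .equal t₁ t₂ => 4 * Nat.pair (termCode varCode t₁) (termCode varCode t₂) + 1
  | _, .rel (l := k) R ts =>
      4 * Nat.pair k (Nat.pair R.1
        (Encodable.encode (List.ofFn fun i => termCode varCode (ts i)))) + 2
  | _, .imp φ ψ => 4 * Nat.pair (formulaCode φ) (formulaCode ψ) + 3
  | _, .all φ => 4 * formulaCode φ + 4

/-- `T` is decidable: the set of (Gödel numbers of) quantifier-free `T`-satisfiable formulas is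
decidable. -/
def IsDecidable {S : Signature} (T : S.lang.Theory) : Prop :=
  ComputablePred fun m : ℕ =>
    ∃ φ : S.lang.Formula ℕ, φ.IsQF ∧ IsSat.{u} T φ ∧ formulaCode φ = m

/-! ### Counting formulas -/

section Counting

variable {L : FirstOrder.Language.{0, 0}}

/-- `xᵢ ≠ xⱼ` for all `i < j`. -/
noncomputable def distinct (n : ℕ) : L.BoundedFormula Empty n :=
  .iInf fun ij : {p : Fin n × Fin n // p.1 < p.2} => ∼((&ij.1.1) =' (&ij.1.2))

/-- A property of one of the variables in scope. -/
abbrev VarProp (L : FirstOrder.Language.{0, 0}) : Type :=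
  ∀ n : ℕ, Fin n → L.BoundedFormula Empty n

/-- `∃ x₁ … xₙ, (xᵢ pairwise distinct) ∧ ⋀ᵢ p(xᵢ)`. -/
noncomputable def atLeast (p : VarProp L) (n : ℕ) : L.Sentence :=
  (distinct n ⊓ .iInf fun i : Fin n => p n i).exs

/-- `∃ x₁ … xₙ, (xᵢ pairwise distinct) ∧ ⋀ᵢ p(xᵢ) ∧ ∀ x, p(x) → ⋁ᵢ x = xᵢ`. -/
noncomputable def exactly (p : VarProp L) (n : ℕ) : L.Sentence :=
  ((distinct n ⊓ .iInf fun i : Fin n => p n i) ⊓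
    ∀' (p (n + 1) (Fin.last n) ⟹
      .iSup fun i : Fin n => (&(Fin.last n)) =' (&i.castSucc))).exs

/-- `∃ x₁ … xₙ, xᵢ pairwise distinct`. -/
noncomputable def sizeGe (n : ℕ) : L.Sentence :=
  (distinct n).exs

/-- `∃ x₁ … xₙ, ∀ y, ⋁ᵢ y = xᵢ`. -/
noncomputable def sizeLe (n : ℕ) : L.Sentence :=
  (∀' .iSup fun i : Fin n => (&(Fin.last n)) =' (&i.castSucc) : L.BoundedFormula Empty n).exs

/-- The domain has exactly `n` elements. -/
noncomputable def sizeEq (n : ℕ) : L.Sentence :=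
  sizeGe n ⊓ sizeLe n

end Counting

/-! ### The theory `T_=` -/

/-- The signature with the `0`-ary predicate symbols `P₁, P₂, …` (`Pₙ` has the name `n`) and no
function symbols. -/
def sigP : Signature where
  funcs _ := ∅
  preds k := {n | k = 0 ∧ 1 ≤ n}

/-- The sentence `Pₙ`. -/
def P (n : ℕ) (hn : 1 ≤ n) : sigP.lang.Sentence :=
  .rel (L := sigP.lang) (l := 0) ⟨n, rfl, hn⟩ Fin.elim0

/-- `T_=`, axiomatized by `Pₙ → ψ_{=n}` for all `n ≥ 1`. -/
noncomputable def TEq : sigP.lang.Theory :=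
  {σ | ∃ (n : ℕ) (hn : 1 ≤ n), σ = P n hn ⟹ sizeEq n}

/-! ### The theories `T_f` -/

/-- The signature with one unary function symbol `s` (with the name `0`) and no predicate
symbols. -/
def sigS : Signature where
  funcs k := {n | k = 1 ∧ n = 0}
  preds _ := ∅

/-- The function symbol `s`. -/
def symS : sigS.lang.Functions 1 := ⟨0, rfl, rfl⟩

/-- `s(x) = x`. -/
def fixed : VarProp sigS.lang := fun _ i => symS.apply₁ (&i) =' (&i)

/-- `¬ s(x) = x`. -/
def nonfixed : VarProp sigS.lang := fun n i => ∼(fixed n i)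

/-- The number of `j ∈ {1, …, k}` with `f j = b`. -/
def count (f : ℕ → Bool) (b : Bool) (k : ℕ) : ℕ :=
  ((Finset.Icc 1 k).filter fun j => f j = b).card

/-- The functions `f` that are used to define `T_f` (only the values of `f` at positive integers
matter, `true` stands for `1` and `false` for `0`): `f` is not computable, `f 1 = 1`, and for
every `k ≥ 1`, `f` takes both values equally often on `{1, …, 2 ^ k}`. -/
structure Admissible (f : ℕ → Bool) : Prop where
  not_computable : ¬ Computable f
  map_one : f 1 = true
  balanced : ∀ k : ℕ, 1 ≤ k → count f true (2 ^ k) = count f false (2 ^ k)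

/-- `T_f`, axiomatized for all `k ≥ 1` by
`[ψ⁼_{≥ f₁(k)} ∧ ψ^≠_{≥ f₀(k)}] ∨ ⋁_{1 ≤ i ≤ k} [ψ⁼_{= f₁(i)} ∧ ψ^≠_{= f₀(i)}]`, where
`f₁(k)` and `f₀(k)` are the numbers of `j ∈ {1, …, k}` with `f j = 1` and `f j = 0`. -/
noncomputable def Tf (f : ℕ → Bool) : sigS.lang.Theory :=
  {σ | ∃ k : ℕ, 1 ≤ k ∧
    σ = (atLeast fixed (count f true k) ⊓ atLeast nonfixed (count f false k)) ⊔
      .iSup fun i : Finset.Icc 1 k =>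
        exactly fixed (count f true i) ⊓ exactly nonfixed (count f false i)}

end TheoryCombination

namespace TheoryCombination

/-! ### Evaluation of quantifier-free formulas on Gödel numbers

The value of a number is `0` if it is not the Gödel number of a quantifier-free formula, `1` if that
formula is false, and `2` if it is true. Values of terms are shifted by one, so that `0` means that
the number is not the Gödel number of a term. -/

/-! A finite model of `Tf f` with n elements has f₁(n) fixed points and f₀(n) other points, because
f₁(k) + f₀(k) = k. An infinite model has infinitely many of both, because balance makes both counts
unbounded (`model_Tf_iff`).

On its own, `Tf f` hides f. Adjoining infinitely many points of both kinds turns any structure into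
a model and preserves quantifier-free formulas, so satisfiability is that of arbitrary structures
with one unary function (`isSat_Tf_iff`). Adjoining suitable numbers of points instead gives
smoothness (`isSmooth_Tf`).

`TEq` can force a finite size by asserting a Pₙ, and this exposes f. In the combination, "Pₙ₊₁ holds
and there are j distinct fixed points" is satisfiable iff j ≤ f₁(n + 1) (`isSat_testFormula_iff`),
so a decision procedure would compute f₁ and then f (`not_isDecidable_combination`).

Decidability of the two components is a small-model argument on Gödel numbers. A formula with number
m only involves terms and predicate symbols with numbers at most m, so an interpretation can be
replaced by a finite table of values at most m (`exists_small_valuation`,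
`exists_small_interpretation`). The table is written as the digits of one bounded number, and a
primitive recursive evaluator, correct by `IsEvaluation.formulaVal_eq_two_iff`, tests all of them
(`computablePred_search`). -/

/-- The value of an equation between terms with the given values. -/
def eqVal (a b : ℕ) : ℕ := if a = 0 ∨ b = 0 then 0 else if a = b then 2 else 1

/-- The value of an implication between formulas with the given values. -/
def impVal (a b : ℕ) : ℕ := if a = 0 ∨ b = 0 then 0 else if a = 2 ∧ b = 1 then 1 else 2

/-- The value of a formula, given the values `tv` of terms and `rv` of relational atoms. -/
def formulaVal (tv rv : ℕ → ℕ) : ℕ → ℕ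
  | 0 => 1
  | c + 1 =>
    if c % 4 = 0 then eqVal (tv (c / 4).unpair.1) (tv (c / 4).unpair.2)
    else if c % 4 = 1 then rv (c / 4)
    else if c % 4 = 2 then
      impVal (formulaVal tv rv (c / 4).unpair.1) (formulaVal tv rv (c / 4).unpair.2)
    else 0
  decreasing_by
    · have := Nat.unpair_left_le (c / 4); omega
    · have := Nat.unpair_right_le (c / 4); omega

theorem primrec₂_eqVal : Primrec₂ eqVal :=
  Primrec.ite (.or (Primrec.eq.comp .fst (.const 0)) (Primrec.eq.comp .snd (.const 0))) (.const 0)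
    (Primrec.ite (Primrec.eq.comp .fst .snd) (.const 2) (.const 1))

theorem primrec₂_impVal : Primrec₂ impVal :=
  Primrec.ite (.or (Primrec.eq.comp .fst (.const 0)) (Primrec.eq.comp .snd (.const 0))) (.const 0)
    (Primrec.ite (.and (Primrec.eq.comp .fst (.const 2)) (Primrec.eq.comp .snd (.const 1)))
      (.const 1) (.const 2))

theorem primrec₂_getD : Primrec₂ fun (l : List ℕ) (i : ℕ) => l[i]?.getD 0 :=
  Primrec.option_getD.comp (Primrec.list_getElem?.comp .fst .snd) (.const 0)

theorem getD_map_range {n i : ℕ} (F : ℕ → ℕ) (hi : i < n) :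
    ((List.range n).map F)[i]?.getD 0 = F i := by
  simp [hi]

section

variable {α : Type*} [Primcodable α]

theorem primrec₂_formulaVal {tv rv : α → ℕ → ℕ} (ht : Primrec₂ tv) (hr : Primrec₂ rv) :
    Primrec₂ fun x => formulaVal (tv x) (rv x) := by
  -- Course-of-values recursion: `l` lists the values at all smaller numbers, so its length is the
  -- number being evaluated.
  let g : α → List ℕ → ℕ := fun x l =>
    Nat.casesOn l.length 1 fun c =>
      if c % 4 = 0 then eqVal (tv x (c / 4).unpair.1) (tv x (c / 4).unpair.2)
      else if c % 4 = 1 then rv x (c / 4)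
      else if c % 4 = 2 then
        impVal (l[(c / 4).unpair.1]?.getD 0) (l[(c / 4).unpair.2]?.getD 0)
      else 0
  have hg : Primrec₂ g := by
    have hc : Primrec fun y : (α × List ℕ) × ℕ => y.2 := .snd
    have hm : Primrec fun y : (α × List ℕ) × ℕ => y.2 % 4 := Primrec.nat_mod.comp hc (.const 4)
    have hd : Primrec fun y : (α × List ℕ) × ℕ => y.2 / 4 := Primrec.nat_div.comp hc (.const 4)
    have h1 := Primrec.fst.comp (Primrec.unpair.comp hd)
    have h2 := Primrec.snd.comp (Primrec.unpair.comp hd)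
    have hx : Primrec fun y : (α × List ℕ) × ℕ => y.1.1 := Primrec.fst.comp .fst
    have hl : Primrec fun y : (α × List ℕ) × ℕ => y.1.2 := Primrec.snd.comp .fst
    exact Primrec.nat_casesOn (Primrec.list_length.comp .snd) (.const 1)
      (Primrec.ite (Primrec.eq.comp hm (.const 0))
        (primrec₂_eqVal.comp (ht.comp hx h1) (ht.comp hx h2))
        (Primrec.ite (Primrec.eq.comp hm (.const 1)) (hr.comp hx hd)
          (Primrec.ite (Primrec.eq.comp hm (.const 2))
            (primrec₂_impVal.comp (primrec₂_getD.comp hl h1) (primrec₂_getD.comp hl h2))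
            (.const 0))))
  refine Primrec.nat_strong_rec _ (Primrec.option_some.comp hg).to₂ fun x n => ?_
  cases n with
  | zero => simp [g, formulaVal]
  | succ c =>
    have h1 : (c / 4).unpair.1 < c + 1 := by have := Nat.unpair_left_le (c / 4); omega
    have h2 : (c / 4).unpair.2 < c + 1 := by have := Nat.unpair_right_le (c / 4); omega
    rw [formulaVal]
    simp only [g, List.length_map, List.length_range, getD_map_range _ h1, getD_map_range _ h2]

end

/-! ### Finite tables as digits of a number, and bounded search -/

/-- The `i`-th digit of `e` in base `b`. -/
def digit (b e i : ℕ) : ℕ := e / b ^ i % b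

theorem primrec₂_pow : Primrec₂ ((· ^ ·) : ℕ → ℕ → ℕ) :=
  Primrec₂.unpaired'.1 Nat.Primrec.pow

theorem exists_digit_eq (m n : ℕ) (g : ℕ → ℕ) (hg : ∀ i, g i ≤ m) :
    ∃ e < (m + 1) ^ n, ∀ i < n, digit (m + 1) e i = g i := by
  let G : Fin n → Fin (m + 1) := fun i => ⟨g i, Nat.lt_succ_of_le (hg i)⟩
  refine ⟨finFunctionFinEquiv G, (finFunctionFinEquiv G).2, fun i hi => ?_⟩
  have := congrFun (finFunctionFinEquiv.symm_apply_apply G) ⟨i, hi⟩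
  exact congrArg Fin.val this

theorem primrec_digit {α : Type*} [Primcodable α] {e i : α → ℕ} {m : α → ℕ} (hm : Primrec m)
    (he : Primrec e) (hi : Primrec i) : Primrec fun x => digit (m x + 1) (e x) (i x) :=
  have hb := Primrec.succ.comp hm
  Primrec.nat_mod.comp (Primrec.nat_div.comp he (primrec₂_pow.comp hb hi)) hb

/-- Bounded search for values of the terms and atoms that make a formula true is computable. -/
theorem computablePred_search {tv rv : ℕ × ℕ → ℕ → ℕ} (ht : Primrec₂ tv) (hr : Primrec₂ rv) :
    ComputablePred fun m : ℕ =>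
      ∃ e < (m + 1) ^ (2 * m + 2), formulaVal (tv (m, e)) (rv (m, e)) m = 2 := by
  have hR : PrimrecRel fun e m : ℕ => formulaVal (tv (m, e)) (rv (m, e)) m = 2 :=
    Primrec.eq.comp ((primrec₂_formulaVal ht hr).comp (Primrec.pair .snd .fst) .snd) (.const 2)
  -- Room for 2m + 2 digits: two tables indexed by 0, …, m for one unary function and a valuation;
  -- `TEq` needs only m + 2, for a size and a valuation.
  have hB : Primrec fun m : ℕ => (m + 1) ^ (2 * m + 2) :=
    primrec₂_pow.comp .succ
      (Primrec.nat_add.comp (Primrec.nat_mul.comp (.const 2) .id) (.const 2))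
  obtain ⟨_, h⟩ := hR.exists_lt.comp hB Primrec.id
  exact ⟨_, h.to_comp⟩

/-! ### Gödel numbers -/

theorem varCode_injective {n : ℕ} : Function.Injective (varCode (n := n)) := by
  rintro (a | a) (b | b) h <;> simp only [varCode] at h
  · congr 1; omega
  · omega
  · omega
  · congr 1; ext; omega

theorem ofFn_encode_inj {n : ℕ} {f g : Fin n → ℕ} :
    Encodable.encode (List.ofFn f) = Encodable.encode (List.ofFn g) ↔ f = g :=
  Encodable.encode_injective.eq_iff.trans List.ofFn_injective.eq_iff

section

variable {S : Signature}

theorem termCode_injective {α : Type} {c : α → ℕ} (hc : Function.Injective c) :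
    Function.Injective (termCode (S := S) c) := by
  intro t
  induction t with
  | var a =>
    rintro (b | ⟨f, ts⟩) h <;> simp only [termCode] at h
    · congr 1; exact hc (by omega)
    · omega
  | @func n f ts ih =>
    rintro (b | ⟨g, us⟩) h <;> simp only [termCode] at h
    · omega
    · have h' := Nat.eq_of_mul_eq_mul_left two_pos (Nat.add_right_cancel h)
      rw [Nat.pair_eq_pair, Nat.pair_eq_pair] at h'
      obtain ⟨rfl, h2, h3⟩ := h'
      rw [ofFn_encode_inj] at h3
      rw [Subtype.ext h2, funext fun i => ih i (congrFun h3 i)]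

theorem formulaCode_injective {n : ℕ} :
    Function.Injective (formulaCode (S := S) (n := n)) := by
  intro φ
  induction φ with
  | falsum => rintro (_ | _ | _ | _ | _) h <;> simp only [formulaCode] at h <;> first | rfl | omega
  | equal t₁ t₂ =>
    rintro (_ | ⟨u₁, u₂⟩ | _ | _ | _) h <;> simp only [formulaCode] at h <;> try omega
    have h' := Nat.eq_of_mul_eq_mul_left four_pos (Nat.add_right_cancel h)
    rw [Nat.pair_eq_pair] at h'
    rw [termCode_injective varCode_injective h'.1, termCode_injective varCode_injective h'.2]
  | @rel _ l R ts =>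
    rintro (_ | _ | ⟨R', us⟩ | _ | _) h <;> simp only [formulaCode] at h <;> try omega
    have h' := Nat.eq_of_mul_eq_mul_left four_pos (Nat.add_right_cancel h)
    rw [Nat.pair_eq_pair, Nat.pair_eq_pair] at h'
    obtain ⟨rfl, h2, h3⟩ := h'
    rw [ofFn_encode_inj] at h3
    rw [Subtype.ext h2, funext fun i => termCode_injective varCode_injective (congrFun h3 i)]
  | imp φ ψ ih₁ ih₂ =>
    rintro (_ | _ | _ | ⟨φ', ψ'⟩ | _) h <;> simp only [formulaCode] at h <;> try omega
    have h' := Nat.eq_of_mul_eq_mul_left four_pos (Nat.add_right_cancel h)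
    rw [Nat.pair_eq_pair] at h'
    rw [ih₁ h'.1, ih₂ h'.2]
  | all φ ih =>
    rintro (_ | _ | _ | _ | φ') h <;> simp only [formulaCode] at h <;> try omega
    rw [ih (by omega : formulaCode φ = formulaCode φ')]

/-- Since Gödel numbers determine formulas, a decision procedure can be queried about one specific
formula; the undecidability reduction needs this. -/
theorem mem_codes_iff {T : S.lang.Theory} {φ : S.lang.Formula ℕ} (hφ : φ.IsQF) :
    (∃ ψ : S.lang.Formula ℕ, ψ.IsQF ∧ IsSat.{u} T ψ ∧ formulaCode ψ = formulaCode φ) ↔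
      IsSat.{u} T φ :=
  ⟨fun ⟨_, _, h, e⟩ => formulaCode_injective e ▸ h, fun h => ⟨φ, hφ, h, rfl⟩⟩

/-! ### Correctness of the evaluation -/

/-- The terms that occur in formulas without bound variables. -/
abbrev FreeTerm (S : Signature) : Type := S.lang.Term (ℕ ⊕ Fin 0)

/-- The value of a term under a valuation of the free variables. -/
abbrev FreeTerm.val {M : Type*} [S.lang.Structure M] (v : ℕ → M) (t : FreeTerm S) : M :=
  t.realize (Sum.elim v default)

/-- The numbers `tv` and `rv` are the values of the terms and relational atoms of `S`. -/
structure IsEvaluation [S.lang.Structure ℕ] (v tv rv : ℕ → ℕ) : Prop where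
  term : ∀ t : FreeTerm S, tv (termCode varCode t) = t.val v + 1
  exists_term : ∀ c, tv c ≠ 0 → ∃ t : FreeTerm S, termCode varCode t = c
  rel_eq_two : ∀ (l : ℕ) (R : S.lang.Relations l) (ts : Fin l → FreeTerm S),
    (rv (Nat.pair l (Nat.pair R.1
      (Encodable.encode (List.ofFn fun i => termCode varCode (ts i))))) = 2 ↔
      Language.Structure.RelMap R fun i => (ts i).val v)
  rel_ne_zero : ∀ (l : ℕ) (R : S.lang.Relations l) (ts : Fin l → FreeTerm S),
    rv (Nat.pair l (Nat.pair R.1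
      (Encodable.encode (List.ofFn fun i => termCode varCode (ts i))))) ≠ 0
  exists_rel : ∀ c, rv c ≠ 0 → ∃ (l : ℕ) (R : S.lang.Relations l) (ts : Fin l → FreeTerm S),
    Nat.pair l (Nat.pair R.1
      (Encodable.encode (List.ofFn fun i => termCode varCode (ts i)))) = c
  rel_le_two : ∀ c, rv c ≤ 2

theorem eqVal_ne_zero {a b : ℕ} : eqVal a b ≠ 0 ↔ a ≠ 0 ∧ b ≠ 0 := by
  unfold eqVal; split_ifs <;> omega

theorem impVal_ne_zero {a b : ℕ} : impVal a b ≠ 0 ↔ a ≠ 0 ∧ b ≠ 0 := by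
  unfold impVal; split_ifs <;> omega

namespace IsEvaluation

variable [S.lang.Structure ℕ] {v tv rv : ℕ → ℕ}

theorem formulaVal_le_two (h : IsEvaluation (S := S) v tv rv) (c : ℕ) :
    formulaVal tv rv c ≤ 2 := by
  cases c with
  | zero => simp [formulaVal]
  | succ c =>
    have := h.rel_le_two (c / 4)
    rw [formulaVal]; unfold eqVal impVal; split_ifs <;> omega

/-- A nonzero value certifies that the number parses: equations and implications pass on the value 0
of their parts, and numbers of quantified formulas get 0. -/
theorem exists_formula (h : IsEvaluation (S := S) v tv rv) (c : ℕ) :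
    formulaVal tv rv c ≠ 0 → ∃ φ : S.lang.Formula ℕ, φ.IsQF ∧ formulaCode φ = c := by
  induction c using Nat.strong_induction_on with
  | _ c ih =>
  cases c with
  | zero => exact fun _ => ⟨.falsum, .falsum, by simp [formulaCode]⟩
  | succ c =>
    rw [formulaVal]
    have h1 := Nat.unpair_left_le (c / 4)
    have h2 := Nat.unpair_right_le (c / 4)
    have hp := Nat.pair_unpair (c / 4)
    split_ifs with h4 h4 h4
    · rw [eqVal_ne_zero]
      rintro ⟨ha, hb⟩
      obtain ⟨t, ht⟩ := h.exists_term _ ha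
      obtain ⟨u, hu⟩ := h.exists_term _ hb
      refine ⟨.equal t u, .of_isAtomic (.equal t u), ?_⟩
      rw [formulaCode, ht, hu, hp]; omega
    · intro hr
      obtain ⟨l, R, ts, e⟩ := h.exists_rel _ hr
      refine ⟨.rel R ts, .of_isAtomic (.rel R ts), ?_⟩
      rw [formulaCode, e]; omega
    · rw [impVal_ne_zero]
      rintro ⟨ha, hb⟩
      obtain ⟨φ, qφ, hφ⟩ := ih _ (by omega) ha
      obtain ⟨ψ, qψ, hψ⟩ := ih _ (by omega) hb
      refine ⟨.imp φ ψ, qφ.imp qψ, ?_⟩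
      rw [formulaCode, hφ, hψ, hp]; omega
    · exact fun h => absurd rfl h

theorem formulaVal_formulaCode (h : IsEvaluation (S := S) v tv rv) {φ : S.lang.Formula ℕ}
    (hφ : φ.IsQF) :
    formulaVal tv rv (formulaCode φ) ≠ 0 ∧
      (formulaVal tv rv (formulaCode φ) = 2 ↔ φ.Realize v) := by
  -- `formulaVal` strips a successor first, so the codes 4k + 1, 4k + 2, 4k + 3 are examined as 4k,
  -- 4k + 1, 4k + 2.
  have d4 : ∀ k, 4 * k / 4 = k := fun k => by omega
  have d41 : ∀ k, (4 * k + 1) / 4 = k := fun k => by omega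
  have d42 : ∀ k, (4 * k + 2) / 4 = k := fun k => by omega
  have m41 : ∀ k, (4 * k + 1) % 4 = 1 := fun k => by omega
  have m42 : ∀ k, (4 * k + 2) % 4 = 2 := fun k => by omega
  unfold Language.Formula.Realize
  induction hφ with
  | falsum => simp [formulaCode, formulaVal, Language.BoundedFormula.Realize]
  | of_isAtomic hat =>
    cases hat with
    | equal t u =>
      change formulaVal tv rv (4 * _ + 1) ≠ 0 ∧ (formulaVal tv rv (4 * _ + 1) = 2 ↔
        FreeTerm.val v t = FreeTerm.val v u)
      rw [formulaVal]
      simp only [d4, Nat.unpair_pair, h.term, eqVal]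
      split_ifs <;> simp_all
    | rel R ts =>
      change formulaVal tv rv (4 * _ + 1 + 1) ≠ 0 ∧ (formulaVal tv rv (4 * _ + 1 + 1) = 2 ↔
        Language.Structure.RelMap R fun i => FreeTerm.val v (ts i))
      rw [formulaVal]
      simp only [m41, d41, one_ne_zero, if_false, if_true]
      exact ⟨h.rel_ne_zero _ R ts, h.rel_eq_two _ R ts⟩
  | @imp φ ψ _ _ ih₁ ih₂ =>
    have l₁ := h.formulaVal_le_two (formulaCode φ)
    have l₂ := h.formulaVal_le_two (formulaCode ψ)
    change formulaVal tv rv (4 * _ + 2 + 1) ≠ 0 ∧ (formulaVal tv rv (4 * _ + 2 + 1) = 2 ↔ _)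
    rw [formulaVal]
    simp only [m42, d42, OfNat.ofNat_ne_zero, if_false, if_true, OfNat.ofNat_ne_one,
      Nat.unpair_pair, impVal_ne_zero, Language.BoundedFormula.realize_imp, ← ih₁.2, ← ih₂.2]
    refine ⟨⟨ih₁.1, ih₂.1⟩, ?_⟩
    have := ih₁.1; have := ih₂.1
    unfold impVal; split_ifs <;> omega

theorem formulaVal_eq_two_iff (h : IsEvaluation (S := S) v tv rv) (c : ℕ) :
    formulaVal tv rv c = 2 ↔
      ∃ φ : S.lang.Formula ℕ, φ.IsQF ∧ φ.Realize v ∧ formulaCode φ = c := by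
  constructor
  · intro hc
    obtain ⟨φ, q, rfl⟩ := h.exists_formula c (by omega)
    exact ⟨φ, q, (h.formulaVal_formulaCode q).2.1 hc, rfl⟩
  · rintro ⟨φ, q, hr, rfl⟩
    exact (h.formulaVal_formulaCode q).2.2 hr

end IsEvaluation

/-- If two interpretations agree on all atoms with small Gödel numbers, then they agree on all
quantifier-free formulas with small Gödel numbers. -/
theorem realize_iff_of_agree {A B : Type*} [S.lang.Structure A] [S.lang.Structure B]
    {v : ℕ → A} {w : ℕ → B} {m : ℕ}
    (ht : ∀ t u : FreeTerm S, termCode varCode t ≤ m → termCode varCode u ≤ m →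
      (t.val v = u.val v ↔ t.val w = u.val w))
    (hr : ∀ (l : ℕ) (R : S.lang.Relations l) (ts : Fin l → FreeTerm S), R.1 ≤ m →
      (Language.Structure.RelMap R (fun i => (ts i).val v) ↔
        Language.Structure.RelMap R fun i => (ts i).val w))
    {φ : S.lang.Formula ℕ} (hφ : φ.IsQF) (hm : formulaCode φ ≤ m) :
    φ.Realize v ↔ φ.Realize w := by
  unfold Language.Formula.Realize
  induction hφ with
  | falsum => rfl
  | of_isAtomic hat =>
    cases hat with
    | equal t u =>
      change 4 * Nat.pair _ _ + 1 ≤ m at hm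
      have h1 := Nat.left_le_pair (termCode varCode t) (termCode varCode u)
      have h2 := Nat.right_le_pair (termCode varCode t) (termCode varCode u)
      exact ht t u (by omega) (by omega)
    | @rel l R ts =>
      change 4 * Nat.pair _ (Nat.pair _ _) + 2 ≤ m at hm
      refine hr l R ts ?_
      generalize Encodable.encode (List.ofFn fun i => termCode varCode (ts i)) = x at hm
      have h1 := Nat.left_le_pair R.1 x
      have h2 := Nat.right_le_pair l (Nat.pair R.1 x)
      omega
  | @imp φ ψ _ _ ih₁ ih₂ =>
    rw [formulaCode] at hm
    have h1 := Nat.left_le_pair (formulaCode φ) (formulaCode ψ)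
    have h2 := Nat.right_le_pair (formulaCode φ) (formulaCode ψ)
    rw [Language.BoundedFormula.realize_imp, Language.BoundedFormula.realize_imp,
      ih₁ (by omega), ih₂ (by omega)]

end

/-- The structure with constants `a`, unary functions `s`, and in which a predicate symbol with the
name `n` holds iff `q n`. -/
abbrev uniformStructure (S : Signature) {A : Type*} (a : A) (s : A → A) (q : ℕ → Prop) :
    S.lang.Structure A where
  funMap {n} _ := match n with
    | 1 => fun xs => s (xs 0)
    | _ => fun _ => a
  RelMap R _ := q R.1

/-! ### Counting formulas -/

section Counting

variable {L : FirstOrder.Language.{0, 0}} {A : Type*} [L.Structure A]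

theorem realize_distinct {n : ℕ} {v : Empty → A} {xs : Fin n → A} :
    (distinct n : L.BoundedFormula Empty n).Realize v xs ↔ Function.Injective xs := by
  simp only [distinct, Language.BoundedFormula.realize_iInf, Language.BoundedFormula.realize_not,
    Language.BoundedFormula.realize_bdEqual, Language.Term.realize_var, Function.comp_apply,
    Sum.elim_inr, Subtype.forall, Prod.forall]
  constructor
  · intro h i j hij
    by_contra hne
    rcases lt_or_gt_of_ne hne with hlt | hlt
    · exact h i j hlt hij
    · exact h j i hlt hij.symm
  · intro h i j hlt hij
    exact hlt.ne (h hij)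

theorem realize_sizeGe {n : ℕ} :
    A ⊨ (sizeGe n : L.Sentence) ↔ ∃ xs : Fin n → A, Function.Injective xs := by
  simp only [sizeGe, Language.Sentence.Realize, Language.BoundedFormula.realize_exs,
    realize_distinct]

theorem realize_sizeLe {n : ℕ} :
    A ⊨ (sizeLe n : L.Sentence) ↔ ∃ xs : Fin n → A, Function.Surjective xs := by
  simp only [sizeLe, Language.Sentence.Realize, Language.BoundedFormula.realize_exs,
    Language.BoundedFormula.realize_all,
    Language.BoundedFormula.realize_iSup, Language.BoundedFormula.realize_bdEqual,
    Language.Term.realize_var, Function.comp_apply, Sum.elim_inr, Fin.snoc_last,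
    Fin.snoc_castSucc]
  exact exists_congr fun xs => forall_congr' fun a => exists_congr fun i => eq_comm

/-- The hypothesis `1 ≤ n` matters because `Nat.card` is 0 on infinite types. -/
theorem realize_sizeEq {n : ℕ} (hn : 1 ≤ n) :
    A ⊨ (sizeEq n : L.Sentence) ↔ Nat.card A = n := by
  have : A ⊨ (sizeEq n : L.Sentence) ↔ A ⊨ (sizeGe n : L.Sentence) ∧ A ⊨ (sizeLe n : L.Sentence) :=
    Language.Formula.realize_inf
  rw [this, realize_sizeGe, realize_sizeLe]
  constructor
  · rintro ⟨⟨f, hf⟩, g, hg⟩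
    have := Finite.of_surjective g hg
    have h1 := Nat.card_le_card_of_injective f hf
    have h2 := Nat.card_le_card_of_surjective g hg
    rw [Nat.card_fin] at h1 h2
    omega
  · intro h
    have : Finite A := Nat.finite_of_card_ne_zero (by omega)
    have e := (Finite.equivFinOfCardEq h).symm
    exact ⟨⟨e, e.injective⟩, e, e.surjective⟩

end Counting

/-! ### Decidability of `T_=` -/

theorem realize_P {A : Type*} [sigP.lang.Structure A] {n : ℕ} (hn : 1 ≤ n) :
    A ⊨ P n hn ↔ Language.Structure.RelMap (L := sigP.lang) (M := A) (n := 0) ⟨n, rfl, hn⟩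
      default := by
  unfold P
  change Language.Structure.RelMap (L := sigP.lang) _ (fun i : Fin 0 => _) ↔ _
  exact iff_of_eq (congrArg _ (Subsingleton.elim _ _))

theorem model_TEq_iff {A : Type*} [sigP.lang.Structure A] :
    A ⊨ TEq ↔ ∀ (n : ℕ) (hn : 1 ≤ n), A ⊨ P n hn → Nat.card A = n := by
  rw [Language.Theory.model_iff]
  constructor
  · intro h n hn hP
    exact (realize_sizeEq hn).1 (Language.Formula.realize_imp.1 (h _ ⟨n, hn, rfl⟩) hP)
  · rintro h _ ⟨n, hn, rfl⟩
    exact Language.Formula.realize_imp.2 fun hP => (realize_sizeEq hn).2 (h n hn hP)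

theorem sigP_term_cases (t : FreeTerm sigP) : ∃ i, t = .var (.inl i) := by
  rcases t with (i | i) | ⟨f, _⟩
  · exact ⟨i, rfl⟩
  · exact i.elim0
  · exact f.2.elim

/-- The values of terms without function symbols. -/
def varVal (v : ℕ → ℕ) (c : ℕ) : ℕ := if c % 4 = 0 then v (c / 4) + 1 else 0

/-- The values of the atoms `P₁, P₂, …` if `Pₙ` holds only for `n = p`. -/
def propVal (p k : ℕ) : ℕ :=
  if k = Nat.pair 0 (Nat.pair k.unpair.2.unpair.1 0) ∧ k.unpair.2.unpair.1 ≠ 0 then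
    if k.unpair.2.unpair.1 = p then 2 else 1
  else 0

/-- Names of predicate symbols start at 1, so `p = 0` encodes that none of them holds. -/
theorem isEvaluation_sigP (v : ℕ → ℕ) (p : ℕ) :
    letI := uniformStructure sigP 0 id (· = p)
    IsEvaluation (S := sigP) v (varVal v) (propVal p) := by
  let := uniformStructure sigP 0 id (· = p)
  have hval (R : ℕ) (h : 1 ≤ R) :
      propVal p (Nat.pair 0 (Nat.pair R 0)) = if R = p then 2 else 1 := by
    simp [propVal, Nat.one_le_iff_ne_zero.1 h]
  constructor
  · intro t
    obtain ⟨i, rfl⟩ := sigP_term_cases t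
    have h1 : 2 * (2 * i) % 4 = 0 := by omega
    have h2 : 2 * (2 * i) / 4 = i := by omega
    simp [termCode, varCode, varVal, h1, h2, FreeTerm.val]
  · intro c hc
    refine ⟨.var (.inl (c / 4)), ?_⟩
    unfold varVal at hc
    split_ifs at hc with h
    · simp only [termCode, varCode]; omega
    · exact absurd rfl hc
  · rintro l ⟨R, rfl, hR⟩ ts
    -- The empty list of arguments has code 0.
    change propVal p (Nat.pair 0 (Nat.pair R 0)) = 2 ↔ R = p
    rw [hval R hR]
    split_ifs <;> simp_all
  · rintro l ⟨R, rfl, hR⟩ ts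
    change propVal p (Nat.pair 0 (Nat.pair R 0)) ≠ 0
    rw [hval R hR]
    split_ifs <;> simp
  · intro c hc
    unfold propVal at hc
    split_ifs at hc with h <;> first
    | exact absurd rfl hc
    | exact ⟨0, ⟨c.unpair.2.unpair.1, rfl, Nat.one_le_iff_ne_zero.2 h.2⟩, Fin.elim0, h.1.symm⟩
  · intro c
    unfold propVal
    split_ifs <;> simp

/-- The truth of a formula in an interpretation that agrees with another one on atoms. -/
theorem sigP_realize_iff {A B : Type*} [sigP.lang.Structure A] [sigP.lang.Structure B]
    {v : ℕ → A} {w : ℕ → B} {m : ℕ}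
    (hv : ∀ i j, i ≤ m → j ≤ m → (v i = v j ↔ w i = w j))
    (hP : ∀ n (hn : 1 ≤ n), n ≤ m → (A ⊨ P n hn ↔ B ⊨ P n hn))
    {φ : sigP.lang.Formula ℕ} (hφ : φ.IsQF) (hm : formulaCode φ ≤ m) :
    φ.Realize v ↔ φ.Realize w := by
  refine realize_iff_of_agree (m := m) (fun t u ht hu => ?_) ?_ hφ hm
  · obtain ⟨i, rfl⟩ := sigP_term_cases t
    obtain ⟨j, rfl⟩ := sigP_term_cases u
    simp only [termCode, varCode] at ht hu
    exact hv i j (by omega) (by omega)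
  · rintro l ⟨R, rfl, hR⟩ ts hRm
    have := hP R hR hRm
    rw [realize_P, realize_P] at this
    rwa [Subsingleton.elim (fun i => FreeTerm.val v (ts i)) default,
      Subsingleton.elim (fun i => FreeTerm.val w (ts i)) default]

/-- If some Pₚ with 1 ≤ p ≤ m holds, the domain has p elements and can be numbered 0, …, p - 1, and
no other Pₙ holds. Otherwise `p = 0`, and each variable is represented by the first variable with
the same value. As `x % 0 = x`, the condition `w i % p = w i` means `w i < p` in the first case and
nothing in the second. -/
theorem exists_small_valuation {A : Type u} [sigP.lang.Structure A] (hA : A ⊨ TEq) (v : ℕ → A)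
    (m : ℕ) : ∃ p ≤ m, ∃ w : ℕ → ℕ, (∀ i, w i ≤ m) ∧ (∀ i, w i % p = w i) ∧
      (∀ i j, i ≤ m → j ≤ m → (v i = v j ↔ w i = w j)) ∧
      ∀ n (hn : 1 ≤ n), n ≤ m → (A ⊨ P n hn ↔ n = p) := by
  classical
  rw [model_TEq_iff] at hA
  by_cases h : ∃ (n : ℕ) (hn : 1 ≤ n), n ≤ m ∧ A ⊨ P n hn
  · obtain ⟨p, hp, hpm, hP⟩ := h
    have hcard := hA p hp hP
    have : Finite A := Nat.finite_of_card_ne_zero (by omega)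
    have e := Finite.equivFinOfCardEq hcard
    refine ⟨p, hpm, fun i => e (v i), fun i => (e (v i)).2.le.trans hpm,
      fun i => Nat.mod_eq_of_lt (e (v i)).2, fun i j _ _ => ?_, fun n hn _ => ?_⟩
    · rw [Fin.val_inj, e.injective.eq_iff]
    · refine ⟨fun hn' => (hA n hn hn').symm.trans hcard, ?_⟩
      rintro rfl
      exact hP
  · have hex (i : ℕ) : ∃ j, v j = v i := ⟨i, rfl⟩
    refine ⟨0, Nat.zero_le m, fun i => min m (Nat.find (hex i)), fun i => min_le_left _ _,
      fun i => Nat.mod_zero _, fun i j hi hj => ?_, fun n hn hm => ?_⟩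
    · have hi' := (Nat.find_min' (hex i) rfl).trans hi
      have hj' := (Nat.find_min' (hex j) rfl).trans hj
      simp only [min_eq_right hi', min_eq_right hj']
      constructor
      · intro e; simp only [e]
      · intro e; rw [← Nat.find_spec (hex i), e, Nat.find_spec (hex j)]
    · exact iff_of_false (fun hP => h ⟨n, hn, hm, hP⟩) (by omega)

theorem isSat_TEq_of_realize {p : ℕ} {w : ℕ → ℕ} (hw : ∀ i, w i % p = w i)
    {φ : sigP.lang.Formula ℕ} (hφ : φ.IsQF)
    (h : letI := uniformStructure sigP 0 id (· = p); φ.Realize w) : IsSat.{u} TEq φ := by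
  let := uniformStructure sigP 0 id (· = p)
  -- This domain has p elements if p > 0 and is all of ℕ if p = 0.
  let A : Type u := ULift {x : ℕ // x % p = x}
  let : sigP.lang.Structure A := uniformStructure sigP ⟨w 0, hw 0⟩ id (· = p)
  have hPA (n : ℕ) (hn : 1 ≤ n) : A ⊨ P n hn ↔ n = p := realize_P hn
  have hPN (n : ℕ) (hn : 1 ≤ n) : ℕ ⊨ P n hn ↔ n = p := realize_P hn
  refine ⟨A, inferInstance, fun i => ⟨w i, hw i⟩, model_TEq_iff.2 fun n hn hP => ?_, ?_⟩
  · obtain rfl := (hPA n hn).1 hP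
    have e : {x : ℕ // x % n = x} ≃ Fin n :=
      { toFun := fun x => ⟨x, x.2 ▸ Nat.mod_lt _ hn⟩
        invFun := fun x => ⟨x, Nat.mod_eq_of_lt x.2⟩
        left_inv := fun _ => rfl
        right_inv := fun _ => rfl }
    rw [Nat.card_congr (Equiv.ulift.trans e), Nat.card_eq_fintype_card, Fintype.card_fin]
  · refine (sigP_realize_iff (fun i j _ _ => ?_) (fun n hn _ => ?_) hφ le_rfl).1 h
    · exact ⟨fun e => ULift.ext _ _ (Subtype.ext e), fun e => congrArg (fun x : A => x.down.1) e⟩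
    · rw [hPA, hPN]

theorem isDecidable_TEq : IsDecidable.{u} TEq := by
  -- Digit 0 is the size p, with 0 for no constraint, and digit i + 1 the value of xᵢ. Reducing
  -- modulo p makes every e a legitimate guess.
  let v : ℕ × ℕ → ℕ → ℕ := fun x i => digit (x.1 + 1) x.2 (i + 1) % digit (x.1 + 1) x.2 0
  have hm : Primrec fun y : (ℕ × ℕ) × ℕ => y.1.1 := Primrec.fst.comp .fst
  have he : Primrec fun y : (ℕ × ℕ) × ℕ => y.1.2 := Primrec.snd.comp .fst
  have hp : Primrec fun y : (ℕ × ℕ) × ℕ => digit (y.1.1 + 1) y.1.2 0 :=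
    primrec_digit hm he (.const 0)
  have ht : Primrec₂ fun x => varVal (v x) := by
    have hc : Primrec fun y : (ℕ × ℕ) × ℕ => y.2 := .snd
    have hd : Primrec fun y : (ℕ × ℕ) × ℕ => y.2 / 4 := Primrec.nat_div.comp hc (.const 4)
    exact Primrec.ite (Primrec.eq.comp (Primrec.nat_mod.comp hc (.const 4)) (.const 0))
      (Primrec.succ.comp (Primrec.nat_mod.comp
        (primrec_digit hm he (Primrec.succ.comp hd)) hp)) (.const 0)
  have hr : Primrec₂ fun x : ℕ × ℕ => propVal (digit (x.1 + 1) x.2 0) := by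
    have hk : Primrec fun y : (ℕ × ℕ) × ℕ => y.2 := .snd
    have hn : Primrec fun y : (ℕ × ℕ) × ℕ => y.2.unpair.2.unpair.1 :=
      Primrec.fst.comp (Primrec.unpair.comp (Primrec.snd.comp (Primrec.unpair.comp hk)))
    exact Primrec.ite
      (.and (Primrec.eq.comp hk (Primrec₂.natPair.comp (.const 0)
        (Primrec₂.natPair.comp hn (.const 0)))) (.not (Primrec.eq.comp hn (.const 0))))
      (Primrec.ite (Primrec.eq.comp hn hp) (.const 2) (.const 1)) (.const 0)
  refine (computablePred_search ht hr).of_eq fun m => ?_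
  have key (e : ℕ) := letI := uniformStructure sigP 0 id (· = digit (m + 1) e 0)
    (isEvaluation_sigP (v (m, e)) (digit (m + 1) e 0)).formulaVal_eq_two_iff m
  simp only [key]
  constructor
  · rintro ⟨e, _, φ, q, h, c⟩
    exact ⟨φ, q, isSat_TEq_of_realize (fun i => Nat.mod_mod _ _) q h, c⟩
  · rintro ⟨φ, q, ⟨A, _, w, hA, h⟩, c⟩
    obtain ⟨p, hpm, w', hw', hmod, heq, hP⟩ := exists_small_valuation hA w m
    obtain ⟨e, he, hdig⟩ := exists_digit_eq m (2 * m + 2) (fun | 0 => p | i + 1 => w' i)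
      (by rintro (_ | i); exacts [hpm, hw' i])
    have hd0 : digit (m + 1) e 0 = p := hdig 0 (by omega)
    refine ⟨e, he, φ, q, ?_, c⟩
    let := uniformStructure sigP 0 id (· = digit (m + 1) e 0)
    refine (sigP_realize_iff (m := m) (fun i j hi hj => ?_) (fun n hn hnm => ?_) q c.le).1 h
    · simp only [v, hd0, hdig (i + 1) (by omega), hdig (j + 1) (by omega), hmod]
      exact heq i j hi hj
    · rw [hP n hn hnm, realize_P, ← hd0]
      rfl

/-! ### Satisfiability over one unary function symbol -/

section

variable {A : Type*} [sigS.lang.Structure A]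

/-- The interpretation of the function symbol `s`. -/
def sMap (a : A) : A := Language.Structure.funMap symS fun _ => a

/-- The term `s(t)`. -/
def sTerm (t : FreeTerm sigS) : FreeTerm sigS := .func symS fun _ => t

@[simp] theorem val_sTerm (v : ℕ → A) (t : FreeTerm sigS) :
    (sTerm t).val v = sMap (t.val v) := rfl

theorem sigS_term_induction {motive : FreeTerm sigS → Prop}
    (var : ∀ i, motive (.var (.inl i))) (app : ∀ t, motive t → motive (sTerm t))
    (t : FreeTerm sigS) : motive t := by
  induction t with
  | var i =>
    rcases i with i | i
    · exact var i
    · exact i.elim0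
  | func f ts ih =>
    obtain ⟨f, rfl, rfl⟩ := f
    have : ts = fun _ => ts 0 := funext fun i => congrArg ts (Subsingleton.elim _ _)
    rw [this]
    exact app _ (ih 0)

end

/-- The Gödel number of `s(t)`, given that of `t`. -/
def succCode (d : ℕ) : ℕ := 2 * Nat.pair 1 (Nat.pair 0 (Nat.pair d 0 + 1)) + 1

/-- The Gödel number of `t`, given that of `s(t)`. -/
def predCode (c : ℕ) : ℕ := ((c / 2).unpair.2.unpair.2 - 1).unpair.1

theorem predCode_succCode (d : ℕ) : predCode (succCode d) = d := by
  have (k : ℕ) : (2 * k + 1) / 2 = k := by omega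
  simp [predCode, succCode, this]

theorem lt_succCode (d : ℕ) : d < succCode d := by
  have h1 := Nat.left_le_pair d 0
  have h2 := Nat.right_le_pair 0 (Nat.pair d 0 + 1)
  have h3 := Nat.right_le_pair 1 (Nat.pair 0 (Nat.pair d 0 + 1))
  unfold succCode
  omega

/-- Compound terms have odd codes and free variables have multiples of 4, so the cases of `termVal`
do not overlap. -/
theorem succCode_mod (d : ℕ) : succCode d % 4 ≠ 0 := by
  unfold succCode
  omega

/-- The part `Nat.pair d 0 + 1` of `succCode` is the code of the one-element list of arguments. -/
theorem termCode_sTerm (t : FreeTerm sigS) :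
    termCode varCode (sTerm t) = succCode (termCode varCode t) := by
  simp [sTerm, termCode, succCode, symS]

/-- The values of terms with one unary function symbol. -/
def termVal (s v : ℕ → ℕ) (c : ℕ) : ℕ :=
  if c % 4 = 0 then v (c / 4) + 1
  else if h : c = succCode (predCode c) then
    if termVal s v (predCode c) = 0 then 0 else s (termVal s v (predCode c) - 1) + 1
  else 0
  decreasing_by all_goals exact h ▸ (predCode_succCode _).symm ▸ lt_succCode _

theorem termVal_succCode (s v : ℕ → ℕ) (d : ℕ) :
    termVal s v (succCode d) = if termVal s v d = 0 then 0 else s (termVal s v d - 1) + 1 := by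
  rw [termVal, if_neg (succCode_mod d)]
  simp only [predCode_succCode, dite_true]

theorem primrec_predCode : Primrec predCode :=
  Primrec.fst.comp (Primrec.unpair.comp (Primrec.pred.comp (Primrec.snd.comp (Primrec.unpair.comp
    (Primrec.snd.comp (Primrec.unpair.comp (Primrec.nat_div.comp .id (.const 2))))))))

theorem primrec_succCode : Primrec succCode :=
  Primrec.nat_double_succ.comp (Primrec₂.natPair.comp (.const 1) (Primrec₂.natPair.comp (.const 0)
    (Primrec.succ.comp (Primrec₂.natPair.comp .id (.const 0)))))

theorem primrec₂_termVal {α : Type*} [Primcodable α] {s v : α → ℕ → ℕ} (hs : Primrec₂ s)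
    (hv : Primrec₂ v) : Primrec₂ fun x => termVal (s x) (v x) := by
  let g : α → List ℕ → ℕ := fun x l =>
    if l.length % 4 = 0 then v x (l.length / 4) + 1
    else if l.length = succCode (predCode l.length) then
      if l[predCode l.length]?.getD 0 = 0 then 0
      else s x (l[predCode l.length]?.getD 0 - 1) + 1
    else 0
  have hg : Primrec₂ g := by
    have hx : Primrec fun y : α × List ℕ => y.1 := .fst
    have hc : Primrec fun y : α × List ℕ => y.2.length := Primrec.list_length.comp .snd
    have hp := primrec_predCode.comp hc
    have hl := primrec₂_getD.comp .snd hp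
    exact Primrec.ite (Primrec.eq.comp (Primrec.nat_mod.comp hc (.const 4)) (.const 0))
      (Primrec.succ.comp (hv.comp hx (Primrec.nat_div.comp hc (.const 4))))
      (Primrec.ite (Primrec.eq.comp hc (primrec_succCode.comp hp))
        (Primrec.ite (Primrec.eq.comp hl (.const 0)) (.const 0)
          (Primrec.succ.comp (hs.comp hx (Primrec.pred.comp hl)))) (.const 0))
  refine Primrec.nat_strong_rec _ (Primrec.option_some.comp hg).to₂ fun x c => ?_
  congr 1
  rw [termVal]
  simp only [g, List.length_map, List.length_range]
  by_cases h1 : c % 4 = 0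
  · rw [if_pos h1, if_pos h1]
  by_cases h2 : c = succCode (predCode c)
  · have h3 : predCode c < c := by
      conv_rhs => rw [h2]
      exact lt_succCode _
    rw [if_neg h1, if_neg h1, if_pos h2, dif_pos h2, getD_map_range _ h3]
  · rw [if_neg h1, if_neg h1, if_neg h2, dif_neg h2]

theorem isEvaluation_sigS (s v : ℕ → ℕ) :
    letI := uniformStructure sigS 0 s fun _ => False
    IsEvaluation (S := sigS) v (termVal s v) fun _ => 0 := by
  let := uniformStructure sigS 0 s fun _ => False
  refine ⟨fun t => ?_, fun c => ?_, fun _ R => R.2.elim, fun _ R => R.2.elim,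
    fun _ h => absurd rfl h, fun _ => Nat.zero_le 2⟩
  · induction t using sigS_term_induction with
    | var i =>
      have h1 : 2 * (2 * i) % 4 = 0 := by omega
      have h2 : 2 * (2 * i) / 4 = i := by omega
      rw [termVal]
      simp [termCode, varCode, h1, h2, FreeTerm.val]
    | app t ih =>
      rw [termCode_sTerm, termVal_succCode, ih]
      rfl
  · induction c using Nat.strong_induction_on with
    | _ c ih =>
    rw [termVal]
    split_ifs with h1 h2 h3
    · refine fun _ => ⟨.var (.inl (c / 4)), ?_⟩
      simp only [termCode, varCode]
      omega
    · exact fun h => absurd rfl h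
    · obtain ⟨t, ht⟩ := ih _ (by conv_rhs => rw [h2]
                                 exact lt_succCode _) h3
      exact fun _ => ⟨sTerm t, by rw [termCode_sTerm, ht, ← h2]⟩
    · exact fun h => absurd rfl h

/-- Every interpretation agrees, on terms with Gödel number at most `m`, with an interpretation
whose values are at most `m`. -/
theorem exists_small_interpretation {A : Type*} [sigS.lang.Structure A] (v : ℕ → A) (m : ℕ) :
    ∃ s w : ℕ → ℕ, (∀ i, s i ≤ m) ∧ (∀ i, w i ≤ m) ∧
      ∀ s' w' : ℕ → ℕ, (∀ i ≤ m, s' i = s i) → (∀ i ≤ m, w' i = w i) →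
        letI := uniformStructure sigS 0 s' fun _ => False
        ∀ t u : FreeTerm sigS, termCode varCode t ≤ m → termCode varCode u ≤ m →
          (t.val v = u.val v ↔ t.val w' = u.val w') := by
  classical
  -- An element is named by the least Gödel number of a term denoting it.
  let rep : A → ℕ := fun a => sInf {c | ∃ t : FreeTerm sigS, termCode varCode t = c ∧ t.val v = a}
  have hrep (t : FreeTerm sigS) :
      ∃ t' : FreeTerm sigS, termCode varCode t' = rep (t.val v) ∧ t'.val v = t.val v :=
    Nat.sInf_mem (s := {c | ∃ u : FreeTerm sigS, termCode varCode u = c ∧ u.val v = t.val v})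
      ⟨_, t, rfl, rfl⟩
  have hle (t : FreeTerm sigS) : rep (t.val v) ≤ termCode varCode t :=
    Nat.sInf_le ⟨t, rfl, rfl⟩
  -- The code of t is sent to the name of the value of s(t). Truncation at m has no effect when s(t)
  -- has code at most m.
  let s : ℕ → ℕ := fun c =>
    if h : ∃ t : FreeTerm sigS, termCode varCode t = c then
      min m (rep (sMap (h.choose.val v))) else 0
  have hs (t : FreeTerm sigS) (ht : termCode varCode (sTerm t) ≤ m) :
      s (rep (t.val v)) = rep (sMap (t.val v)) := by
    obtain ⟨t', h1, h2⟩ := hrep t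
    have hex : ∃ t' : FreeTerm sigS, termCode varCode t' = rep (t.val v) := ⟨t', h1⟩
    have h3 : hex.choose = t' :=
      termCode_injective varCode_injective (hex.choose_spec.trans h1.symm)
    simp only [s, dif_pos hex, h3, h2]
    exact min_eq_right ((hle (sTerm t)).trans ht)
  refine ⟨s, fun i => min m (rep (v i)), fun i => ?_, fun i => min_le_left _ _, ?_⟩
  · simp only [s]
    split_ifs
    exacts [min_le_left _ _, Nat.zero_le m]
  -- Only the entries up to m can be recovered from the digits of a number, hence arbitrary `s'` and
  -- `w'` that agree up to m.
  · intro s' w' hs' hw'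
    let := uniformStructure sigS 0 s' fun _ => False
    have key (t : FreeTerm sigS) (ht : termCode varCode t ≤ m) :
        FreeTerm.val w' t = rep (t.val v) := by
      induction t using sigS_term_induction with
      | var i =>
        have h1 := (hle (.var (.inl i))).trans ht
        simp only [termCode, varCode] at ht
        exact (hw' i (by omega)).trans (min_eq_right h1)
      | app t ih =>
        have h1 : termCode varCode t ≤ m :=
          (lt_succCode _).le.trans ((termCode_sTerm t).ge.trans ht)
        change s' (FreeTerm.val w' t) = rep (sMap (t.val v))
        rw [ih h1, hs' _ ((hle t).trans h1), hs t ht]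
    intro t u ht hu
    rw [key t ht, key u hu]
    refine ⟨fun e => by rw [e], fun e => ?_⟩
    obtain ⟨t', h1, h2⟩ := hrep t
    obtain ⟨u', h3, h4⟩ := hrep u
    rw [← h2, ← h4, termCode_injective varCode_injective (h1.trans (e.trans h3.symm))]

/-- Satisfiability of quantifier-free formulas in structures for one unary function symbol is
computable. -/
theorem computablePred_sigS : ComputablePred fun m : ℕ =>
    ∃ φ : sigS.lang.Formula ℕ, φ.IsQF ∧
      (∃ (A : Type u) (_ : sigS.lang.Structure A) (v : ℕ → A), φ.Realize v) ∧
      formulaCode φ = m := by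
  -- Even digits tabulate the function, odd digits the valuation.
  let s : ℕ × ℕ → ℕ → ℕ := fun x i => digit (x.1 + 1) x.2 (2 * i)
  let w : ℕ × ℕ → ℕ → ℕ := fun x i => digit (x.1 + 1) x.2 (2 * i + 1)
  have hm : Primrec fun y : (ℕ × ℕ) × ℕ => y.1.1 := Primrec.fst.comp .fst
  have he : Primrec fun y : (ℕ × ℕ) × ℕ => y.1.2 := Primrec.snd.comp .fst
  have hs : Primrec₂ s := primrec_digit hm he (Primrec.nat_double.comp .snd)
  have hw : Primrec₂ w := primrec_digit hm he (Primrec.nat_double_succ.comp .snd)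
  refine (computablePred_search (primrec₂_termVal hs hw) (Primrec₂.const 0)).of_eq fun m => ?_
  have key (e : ℕ) := letI := uniformStructure sigS 0 (s (m, e)) fun _ => False
    (isEvaluation_sigS (s (m, e)) (w (m, e))).formulaVal_eq_two_iff m
  simp only [key]
  constructor
  · rintro ⟨e, _, φ, q, h, c⟩
    let := uniformStructure sigS 0 (s (m, e)) fun _ => False
    let : sigS.lang.Structure (ULift.{u} ℕ) :=
      uniformStructure sigS ⟨0⟩ (fun x => ⟨s (m, e) x.down⟩) fun _ => False
    refine ⟨φ, q, ⟨ULift ℕ, inferInstance, fun i => ⟨w (m, e) i⟩, ?_⟩, c⟩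
    have hval (t : FreeTerm sigS) : t.val (fun i => ULift.up.{u} (w (m, e) i)) =
        ⟨t.val (w (m, e))⟩ := by
      induction t using sigS_term_induction with
      | var i => rfl
      | app t ih => rw [val_sTerm, ih]; rfl
    refine (realize_iff_of_agree (fun t u _ _ => ?_)
      (fun _ (R : sigS.preds _) => R.2.elim) q le_rfl).1 h
    rw [hval, hval, ULift.up_inj]
  · rintro ⟨φ, q, ⟨A, _, v, h⟩, c⟩
    obtain ⟨s₀, w₀, hs₀, hw₀, H⟩ := exists_small_interpretation v m
    obtain ⟨e, he, hdig⟩ := exists_digit_eq m (2 * m + 2)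
      (fun i => if i % 2 = 0 then s₀ (i / 2) else w₀ (i / 2))
      (fun i => by split_ifs; exacts [hs₀ _, hw₀ _])
    refine ⟨e, he, φ, q, ?_, c⟩
    let := uniformStructure sigS 0 (s (m, e)) fun _ => False
    refine (realize_iff_of_agree (H (s (m, e)) (w (m, e)) (fun i hi => ?_) (fun i hi => ?_))
      (fun _ (R : sigS.preds _) => R.2.elim) q c.le).1 h
    · have h1 : 2 * i % 2 = 0 := by omega
      have h2 : 2 * i / 2 = i := by omega
      simp only [s, hdig (2 * i) (by omega), h1, h2, if_true]
    · have h1 : (2 * i + 1) % 2 ≠ 0 := by omega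
      have h2 : (2 * i + 1) / 2 = i := by omega
      simp only [w, hdig (2 * i + 1) (by omega), h1, h2, if_false]

/-! ### Models of `T_f` -/

section

variable {L : FirstOrder.Language.{0, 0}} {A : Type u} [L.Structure A] {p : VarProp L}
  {Q : A → Prop}

theorem realize_atLeast (hp : ∀ n i (v : Empty → A) xs, (p n i).Realize v xs ↔ Q (xs i)) {n : ℕ} :
    A ⊨ atLeast p n ↔ (n : Cardinal.{u}) ≤ #{a // Q a} := by
  simp only [atLeast, Language.Sentence.Realize, Language.BoundedFormula.realize_exs,
    Language.BoundedFormula.realize_inf, realize_distinct, Language.BoundedFormula.realize_iInf, hp]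
  rw [← Cardinal.lift_natCast.{u, 0}, ← Cardinal.mk_fin, ← Cardinal.lift_id'.{0, u} #{a // Q a},
    Cardinal.lift_mk_le']
  constructor
  · rintro ⟨xs, hi, hQ⟩
    exact ⟨fun i => ⟨xs i, hQ i⟩, fun i j h => hi (congrArg Subtype.val h)⟩
  · rintro ⟨g⟩
    exact ⟨fun i => (g i).1, fun i j h => g.injective (Subtype.ext h), fun i => (g i).2⟩

theorem realize_exactly (hp : ∀ n i (v : Empty → A) xs, (p n i).Realize v xs ↔ Q (xs i)) {n : ℕ} :
    A ⊨ exactly p n ↔ #{a // Q a} = n := by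
  simp only [exactly, Language.Sentence.Realize, Language.BoundedFormula.realize_exs,
    Language.BoundedFormula.realize_inf, realize_distinct, Language.BoundedFormula.realize_iInf, hp,
    Language.BoundedFormula.realize_all, Language.BoundedFormula.realize_imp,
    Language.BoundedFormula.realize_iSup, Language.BoundedFormula.realize_bdEqual,
    Language.Term.realize_var, Function.comp_apply, Sum.elim_inr, Fin.snoc_last, Fin.snoc_castSucc]
  rw [Cardinal.mk_eq_nat_iff]
  constructor
  · rintro ⟨xs, ⟨hi, hQ⟩, hs⟩
    refine ⟨(Equiv.ofBijective (fun i => (⟨xs i, hQ i⟩ : {a // Q a}))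
      ⟨fun i j h => hi (congrArg Subtype.val h), fun ⟨a, ha⟩ => ?_⟩).symm⟩
    obtain ⟨i, rfl⟩ := hs a ha
    exact ⟨i, rfl⟩
  · rintro ⟨e⟩
    refine ⟨fun i => (e.symm i).1, ⟨fun i j h => e.symm.injective (Subtype.ext h),
      fun i => (e.symm i).2⟩, fun a ha => ⟨e ⟨a, ha⟩, ?_⟩⟩
    simp only [Equiv.symm_apply_apply]

end

theorem count_add_count (f : ℕ → Bool) (k : ℕ) : count f true k + count f false k = k := by
  have := Finset.card_filter_add_card_filter_not (s := Finset.Icc 1 k) fun j => f j = true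
  simpa [count] using this

theorem count_mono (f : ℕ → Bool) (b : Bool) : Monotone (count f b) := fun _ _ h =>
  Finset.card_le_card (Finset.filter_subset_filter _ (Finset.Icc_subset_Icc_right h))

theorem count_succ (f : ℕ → Bool) (b : Bool) (k : ℕ) :
    count f b (k + 1) = count f b k + if f (k + 1) = b then 1 else 0 := by
  unfold count
  rw [← Finset.insert_Icc_right_eq_Icc_add_one (Nat.le_add_left 1 k), Finset.filter_insert]
  split_ifs
  · rw [Finset.card_insert_of_notMem (by simp)]
  · rfl

/-- Each value is taken 2 ^ n > n times up to 2 ^ (n + 1). Unboundedness of both counts is the only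
use made of balance. -/
theorem Admissible.le_count {f : ℕ → Bool} (hf : Admissible f) (b : Bool) (n : ℕ) :
    n ≤ count f b (2 ^ (n + 1)) := by
  have h1 := hf.balanced (n + 1) (Nat.le_add_left 1 n)
  have h2 := count_add_count f (2 ^ (n + 1))
  have h3 : n < 2 ^ n := Nat.lt_two_pow_self
  have h4 : 2 ^ (n + 1) = 2 ^ n * 2 := pow_succ 2 n
  cases b <;> omega

section

variable {A : Type u} [sigS.lang.Structure A]

theorem realize_fixed (n : ℕ) (i : Fin n) (v : Empty → A) (xs : Fin n → A) :
    (fixed n i).Realize v xs ↔ sMap (xs i) = xs i := by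
  rw [fixed, Language.BoundedFormula.realize_bdEqual, Language.Term.realize_functions_apply₁]
  have : ![xs i] = fun _ => xs i := funext fun j => by rw [Subsingleton.elim j 0]; rfl
  exact iff_of_eq (congrArg (fun ys => Language.Structure.funMap symS ys = xs i) this)

theorem realize_nonfixed (n : ℕ) (i : Fin n) (v : Empty → A) (xs : Fin n → A) :
    (nonfixed n i).Realize v xs ↔ sMap (xs i) ≠ xs i := by
  rw [nonfixed, Language.BoundedFormula.realize_not, realize_fixed]

/-- If no exact pair of counts occurs, every axiom holds through its first disjunct, and the
unbounded counts make both cardinals infinite. Conversely, the exact pair at i satisfies the axioms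
for k ≥ i by the second disjunct and those for k ≤ i by monotonicity of the counts. -/
theorem model_Tf_iff {f : ℕ → Bool} (hf : Admissible f) :
    A ⊨ Tf f ↔
      (∃ k, 1 ≤ k ∧ #{a : A // sMap a = a} = count f true k ∧
        #{a : A // sMap a ≠ a} = count f false k) ∨
      (ℵ₀ ≤ #{a : A // sMap a = a} ∧ ℵ₀ ≤ #{a : A // sMap a ≠ a}) := by
  have key : A ⊨ Tf f ↔ ∀ k, 1 ≤ k →
      ((count f true k : Cardinal.{u}) ≤ #{a : A // sMap a = a} ∧
        (count f false k : Cardinal.{u}) ≤ #{a : A // sMap a ≠ a}) ∨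
      ∃ i, (1 ≤ i ∧ i ≤ k) ∧ #{a : A // sMap a = a} = count f true i ∧
        #{a : A // sMap a ≠ a} = count f false i := by
    have hax (k : ℕ) : A ⊨ ((atLeast fixed (count f true k) ⊓ atLeast nonfixed (count f false k)) ⊔
        .iSup fun i : Finset.Icc 1 k =>
          exactly fixed (count f true i) ⊓ exactly nonfixed (count f false i) :
            sigS.lang.Sentence) ↔ _ :=
      Language.BoundedFormula.realize_sup.trans
        (or_congr Language.BoundedFormula.realize_inf Language.BoundedFormula.realize_iSup)
    simp only [Language.BoundedFormula.realize_inf] at hax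
    change ∀ k, _ ↔ ((A ⊨ atLeast fixed (count f true k) ∧ A ⊨ atLeast nonfixed (count f false k)) ∨
      ∃ i : Finset.Icc 1 k, A ⊨ exactly fixed (count f true i) ∧
        A ⊨ exactly nonfixed (count f false i)) at hax
    have h1 (n : ℕ) := realize_atLeast (A := A) (Q := fun a => sMap a = a) realize_fixed (n := n)
    have h2 (n : ℕ) :=
      realize_atLeast (A := A) (Q := fun a => sMap a ≠ a) realize_nonfixed (n := n)
    have h3 (n : ℕ) := realize_exactly (A := A) (Q := fun a => sMap a = a) realize_fixed (n := n)
    have h4 (n : ℕ) :=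
      realize_exactly (A := A) (Q := fun a => sMap a ≠ a) realize_nonfixed (n := n)
    simp only [h1, h2, h3, h4, Subtype.exists, Finset.mem_Icc, exists_prop] at hax
    rw [Language.Theory.model_iff]
    constructor
    · exact fun h k hk => (hax k).1 (h _ ⟨k, hk, rfl⟩)
    · rintro h _ ⟨k, hk, rfl⟩
      exact (hax k).2 (h k hk)
  rw [key]
  constructor
  · intro h
    by_cases hex : ∃ k, 1 ≤ k ∧ #{a : A // sMap a = a} = count f true k ∧
        #{a : A // sMap a ≠ a} = count f false k
    · exact .inl hex
    · have h' (k : ℕ) (hk : 1 ≤ k) := (h k hk).resolve_right fun ⟨i, hi, e⟩ => hex ⟨i, hi.1, e⟩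
      refine .inr ⟨Cardinal.aleph0_le.2 fun n => ?_, Cardinal.aleph0_le.2 fun n => ?_⟩
      · exact (Nat.cast_le.2 (hf.le_count true n)).trans (h' _ Nat.one_le_two_pow).1
      · exact (Nat.cast_le.2 (hf.le_count false n)).trans (h' _ Nat.one_le_two_pow).2
  · rintro (⟨i, hi, h1, h2⟩ | ⟨h1, h2⟩) k hk
    · rcases le_total i k with hik | hik
      · exact .inr ⟨i, ⟨hi, hik⟩, h1, h2⟩
      · rw [h1, h2]
        exact .inl ⟨Nat.cast_le.2 (count_mono f _ hik), Nat.cast_le.2 (count_mono f _ hik)⟩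
    · exact .inl ⟨(natCast_le_aleph0).trans h1, (natCast_le_aleph0).trans h2⟩

/-- Embeddings preserve and reflect quantifier-free formulas. -/
theorem realize_comp_of_injective {B : Type*} [sigS.lang.Structure B] {g : A → B}
    (hg : Function.Injective g) (hs : ∀ a, sMap (g a) = g (sMap a)) (v : ℕ → A)
    {φ : sigS.lang.Formula ℕ} (hφ : φ.IsQF) : φ.Realize v ↔ φ.Realize (g ∘ v) := by
  have hval (t : FreeTerm sigS) : t.val (g ∘ v) = g (t.val v) := by
    induction t using sigS_term_induction with
    | var i => rfl
    | app t ih => rw [val_sTerm, ih, hs, val_sTerm]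
  refine realize_iff_of_agree (fun t u _ _ => ?_) (fun _ (R : sigS.preds _) => R.2.elim) hφ le_rfl
  rw [hval, hval, hg.eq_iff]

end

/-! ### Extending interpretations; decidability and smoothness of `Tf f` -/

/-- The unary function on `A ⊕ X ⊕ Y` that extends `s`, is the identity on `X`, and maps all
elements of `Y` to `a`. -/
def extend {A X Y : Type*} (s : A → A) (a : A) : A ⊕ X ⊕ Y → A ⊕ X ⊕ Y
  | .inl b => .inl (s b)
  | .inr (.inl x) => .inr (.inl x)
  | .inr (.inr _) => .inl a

section

variable {A X Y : Type u} (s : A → A) (a : A)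

theorem mk_fixed_extend :
    #{b : A ⊕ X ⊕ Y // extend s a b = b} = #{b // s b = b} + #X := by
  rw [Cardinal.mk_congr Equiv.subtypeSum, ← Cardinal.add_def,
    Cardinal.mk_congr (Equiv.subtypeSum (α := X)), ← Cardinal.add_def]
  have h1 : #{b : A // extend (X := X) (Y := Y) s a (.inl b) = .inl b} = #{b // s b = b} :=
    Cardinal.mk_congr (Equiv.subtypeEquivRight fun b => Sum.inl_injective.eq_iff)
  have h2 : #{x : X // extend (A := A) (Y := Y) s a (.inr (.inl x)) = .inr (.inl x)} = #X :=
    Cardinal.mk_congr (Equiv.subtypeUnivEquiv fun _ => rfl)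
  have h3 : #{y : Y // extend (A := A) (X := X) s a (.inr (.inr y)) = .inr (.inr y)} = 0 :=
    Cardinal.mk_eq_zero_iff.2 ⟨fun y => Sum.inl_ne_inr y.2⟩
  rw [h1, h2, h3, add_zero]

theorem mk_nonfixed_extend :
    #{b : A ⊕ X ⊕ Y // extend s a b ≠ b} = #{b // s b ≠ b} + #Y := by
  rw [Cardinal.mk_congr Equiv.subtypeSum, ← Cardinal.add_def,
    Cardinal.mk_congr (Equiv.subtypeSum (α := X)), ← Cardinal.add_def]
  have h1 : #{b : A // extend (X := X) (Y := Y) s a (.inl b) ≠ .inl b} = #{b // s b ≠ b} :=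
    Cardinal.mk_congr (Equiv.subtypeEquivRight fun b => not_congr Sum.inl_injective.eq_iff)
  have h2 : #{x : X // extend (A := A) (Y := Y) s a (.inr (.inl x)) ≠ .inr (.inl x)} = 0 :=
    Cardinal.mk_eq_zero_iff.2 ⟨fun x => x.2 rfl⟩
  have h3 : #{y : Y // extend (A := A) (X := X) s a (.inr (.inr y)) ≠ .inr (.inr y)} = #Y :=
    Cardinal.mk_congr (Equiv.subtypeUnivEquiv fun _ => Sum.inl_ne_inr)
  rw [h1, h2, h3, zero_add]

end

/-- Every interpretation can be extended by fixed points and by points that are not fixed. -/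
theorem exists_extension {A : Type u} [sigS.lang.Structure A] (v : ℕ → A) (X Y : Type u)
    {φ : sigS.lang.Formula ℕ} (hφ : φ.IsQF) (h : φ.Realize v) :
    ∃ (_ : sigS.lang.Structure (A ⊕ X ⊕ Y)) (w : ℕ → A ⊕ X ⊕ Y),
      #{b : A ⊕ X ⊕ Y // sMap b = b} = #{b : A // sMap b = b} + #X ∧
      #{b : A ⊕ X ⊕ Y // sMap b ≠ b} = #{b : A // sMap b ≠ b} + #Y ∧ φ.Realize w := by
  let : sigS.lang.Structure (A ⊕ X ⊕ Y) :=
    uniformStructure sigS (.inl (v 0)) (extend sMap (v 0)) fun _ => False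
  exact ⟨inferInstance, _, mk_fixed_extend _ _, mk_nonfixed_extend _ _,
    (realize_comp_of_injective Sum.inl_injective (fun _ => rfl) v hφ).1 h⟩

/-- Adjoining countably many fixed and countably many non-fixed points gives a model whatever f is;
the right side does not mention f. -/
theorem isSat_Tf_iff {f : ℕ → Bool} (hf : Admissible f) {φ : sigS.lang.Formula ℕ} (hφ : φ.IsQF) :
    IsSat.{u} (Tf f) φ ↔ ∃ (A : Type u) (_ : sigS.lang.Structure A) (v : ℕ → A), φ.Realize v := by
  constructor
  · rintro ⟨A, i, v, _, h⟩
    exact ⟨A, i, v, h⟩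
  · rintro ⟨A, _, v, h⟩
    obtain ⟨i, w, h1, h2, h3⟩ := exists_extension v (ULift ℕ) (ULift ℕ) hφ h
    refine ⟨_, i, w, (model_Tf_iff hf).2 (.inr ⟨?_, ?_⟩), h3⟩
    · rw [h1]; simp
    · rw [h2]; simp

theorem isDecidable_Tf {f : ℕ → Bool} (hf : Admissible f) : IsDecidable.{u} (Tf f) :=
  computablePred_sigS.of_eq fun _ =>
    exists_congr fun _ => and_congr_right fun q => and_congr_left' (isSat_Tf_iff hf q).symm

theorem mk_fixed_add_mk_nonfixed {A : Type u} [sigS.lang.Structure A] :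
    #{b : A // sMap b = b} + #{b : A // sMap b ≠ b} = #A :=
  Cardinal.mk_sum_compl {b : A | sMap b = b}

theorem isSmooth_Tf {f : ℕ → Bool} (hf : Admissible f) : IsSmooth.{u} (Tf f) := by
  intro φ q A _ v hA h κ hκ
  rcases lt_or_ge κ ℵ₀ with hfin | hinf
  · obtain ⟨n, rfl⟩ := Cardinal.lt_aleph0.1 hfin
    have hk : ∃ k, 1 ≤ k ∧ #{a : A // sMap a = a} = count f true k ∧
        #{a : A // sMap a ≠ a} = count f false k := by
      refine ((model_Tf_iff hf).1 hA).resolve_right fun h => ?_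
      exact (h.1.trans (Cardinal.mk_subtype_le _)).not_gt (hκ.trans hfin)
    obtain ⟨k, -, h1, h2⟩ := hk
    have hkn : k < n := by
      rw [← mk_fixed_add_mk_nonfixed, h1, h2, ← Nat.cast_add, count_add_count] at hκ
      exact_mod_cast hκ
    have hc (b : Bool) : count f b k + (count f b n - count f b k) = count f b n :=
      Nat.add_sub_of_le (count_mono f b hkn.le)
    -- From size k to size n, exactly the missing fixed and non-fixed points are added.
    obtain ⟨i, w, h3, h4, h5⟩ := exists_extension v (ULift (Fin (count f true n - count f true k)))
      (ULift (Fin (count f false n - count f false k))) q h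
    rw [h1, Cardinal.mk_uLift, Cardinal.mk_fin, Cardinal.lift_natCast, ← Nat.cast_add, hc] at h3
    rw [h2, Cardinal.mk_uLift, Cardinal.mk_fin, Cardinal.lift_natCast, ← Nat.cast_add, hc] at h4
    refine ⟨_, i, w, ?_, (model_Tf_iff hf).2 (.inl ⟨n, by omega, h3, h4⟩), h5⟩
    rw [← mk_fixed_add_mk_nonfixed, h3, h4, ← Nat.cast_add, count_add_count]
  -- Adding κ points of each kind gives total size κ, since #A < κ and κ is infinite.
  · obtain ⟨i, w, h3, h4, h5⟩ := exists_extension v κ.out κ.out q h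
    rw [Cardinal.mk_out] at h3 h4
    refine ⟨_, i, w, ?_, (model_Tf_iff hf).2 (.inr ⟨?_, ?_⟩), h5⟩
    · rw [Cardinal.mk_sum, Cardinal.mk_sum, Cardinal.mk_out, Cardinal.lift_id, Cardinal.lift_id,
        Cardinal.lift_id, Cardinal.add_eq_self hinf, Cardinal.add_eq_right hinf hκ.le]
    · exact h3 ▸ hinf.trans (self_le_add_left _ _)
    · exact h4 ▸ hinf.trans (self_le_add_left _ _)

/-! ### Existence of admissible functions -/

theorem exists_not_computable : ∃ g : ℕ → Bool, g 0 = true ∧ ¬ Computable g := by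
  classical
  let p : Nat.Partrec.Code → Prop := fun c => (c.eval 0).Dom
  -- The halting problem, shifted by one so that the value at 0 can be prescribed.
  let g : ℕ → Bool := fun n => Nat.casesOn n true fun k => decide (p (Denumerable.ofNat _ k))
  refine ⟨g, rfl, fun hg => ComputablePred.halting_problem 0 ⟨inferInstance, ?_⟩⟩
  refine (hg.comp (Computable.succ.comp Computable.encode)).of_eq fun c => ?_
  simp [g, p]

theorem exists_admissible : ∃ f : ℕ → Bool, Admissible f := by
  obtain ⟨g, hg0, hg⟩ := exists_not_computable
  -- The positions 2m + 1 and 2m + 2 carry g(m) and its negation, so every prefix of even length is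
  -- balanced, and g is recovered from the odd positions.
  let f : ℕ → Bool := fun n => if n % 2 = 1 then g (n / 2) else !g (n / 2 - 1)
  have hodd (m : ℕ) : f (2 * m + 1) = g m := by
    have h1 : (2 * m + 1) % 2 = 1 := by omega
    have h2 : (2 * m + 1) / 2 = m := by omega
    simp only [f, h1, h2, if_true]
  have heven (m : ℕ) : f (2 * m + 1 + 1) = !g m := by
    have h1 : (2 * m + 1 + 1) % 2 ≠ 1 := by omega
    have h2 : (2 * m + 1 + 1) / 2 - 1 = m := by omega
    simp only [f, h1, h2, if_false]
  have hcount (b : Bool) (m : ℕ) : count f b (2 * m) = m := by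
    induction m with
    | zero => simp [count]
    | succ m ih =>
      rw [Nat.mul_succ, count_succ, count_succ, hodd, heven, ih]
      cases b <;> cases g m <;> simp
  refine ⟨f, fun hf => hg ?_, (hodd 0).trans hg0, fun k hk => ?_⟩
  · exact (hf.comp Primrec.nat_double_succ.to_comp).of_eq hodd
  · obtain ⟨k, rfl⟩ := Nat.exists_eq_add_of_le' hk
    rw [pow_succ', hcount, hcount]

/-! ### Undecidability of the combination -/

section Formulas

/-- The signature of the combination. -/
abbrev sigU : Signature := sigP.union sigS

/-- The variable `xᵢ`. -/
def varU (i : ℕ) : FreeTerm sigU := .var (.inl i)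

/-- The term `s(xᵢ)`. -/
def sVarU (i : ℕ) : FreeTerm sigU :=
  .func ((sigP.inclRight sigS).onFunction symS) fun _ => varU i

/-- `s(xₐ) = xₐ` if `a = b`, and `xₐ ≠ x_b` otherwise. -/
def pairFormula (a b : ℕ) : sigU.lang.Formula ℕ :=
  if a = b then .equal (sVarU a) (varU a) else .imp (.equal (varU a) (varU b)) .falsum

/-- The negation of the conjunction of the formulas `pairFormula (i / j) (i % j)` for `i < k`. -/
def notPairs (j : ℕ) : ℕ → sigU.lang.Formula ℕ
  | 0 => .falsum
  | k + 1 => .imp (pairFormula (k / j) (k % j)) (notPairs j k)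

/-- The predicate symbol with the name `n + 1`. -/
def symP (n : ℕ) : sigP.lang.Relations 0 := ⟨n + 1, rfl, Nat.le_add_left 1 n⟩

/-- `Pₙ₊₁`, and `x₀, …, xⱼ₋₁` are distinct fixed points of `s`. -/
def testFormula (n j : ℕ) : sigU.lang.Formula ℕ :=
  .imp (.imp (.rel ((sigP.inclLeft sigS).onRelation (symP n)) Fin.elim0) (notPairs j (j * j)))
    .falsum

theorem isQF_pairFormula (a b : ℕ) : (pairFormula a b).IsQF := by
  unfold pairFormula
  split_ifs
  · exact .of_isAtomic (.equal _ _)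
  · exact .imp (.of_isAtomic (.equal _ _)) .falsum

theorem isQF_notPairs (j k : ℕ) : (notPairs j k).IsQF := by
  induction k with
  | zero => exact .falsum
  | succ k ih => exact .imp (isQF_pairFormula _ _) ih

theorem isQF_testFormula (n j : ℕ) : (testFormula n j).IsQF :=
  .imp (.imp (.of_isAtomic (.rel _ _)) (isQF_notPairs _ _)) .falsum

/-- The Gödel number of `pairFormula a b`. -/
def pairFormulaCode (a b : ℕ) : ℕ :=
  if a = b then 4 * Nat.pair (succCode (2 * (2 * a))) (2 * (2 * a)) + 1
  else 4 * Nat.pair (4 * Nat.pair (2 * (2 * a)) (2 * (2 * b)) + 1) 0 + 3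

/-- The Gödel number of `notPairs j k`. -/
def notPairsCode (j k : ℕ) : ℕ :=
  Nat.rec 0 (fun i r => 4 * Nat.pair (pairFormulaCode (i / j) (i % j)) r + 3) k

/-- The Gödel number of `testFormula n j`. -/
def testFormulaCode (n j : ℕ) : ℕ :=
  4 * Nat.pair (4 * Nat.pair (4 * Nat.pair 0 (Nat.pair (n + 1) 0) + 2)
    (notPairsCode j (j * j)) + 3) 0 + 3

theorem formulaCode_pairFormula (a b : ℕ) :
    formulaCode (pairFormula a b) = pairFormulaCode a b := by
  unfold pairFormula pairFormulaCode
  split_ifs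
  · simp [formulaCode, termCode, sVarU, varU, varCode, succCode, symS, Signature.inclRight]
  · simp [formulaCode, termCode, varU, varCode]

theorem formulaCode_notPairs (j k : ℕ) : formulaCode (notPairs j k) = notPairsCode j k := by
  induction k with
  | zero => rfl
  | succ k ih =>
    rw [notPairs, formulaCode, formulaCode_pairFormula, ih]
    rfl

theorem formulaCode_testFormula (n j : ℕ) :
    formulaCode (testFormula n j) = testFormulaCode n j := by
  simp [testFormula, testFormulaCode, formulaCode, formulaCode_notPairs, Signature.inclLeft, symP]

theorem primrec_four_mul_add {α : Type*} [Primcodable α] {g : α → ℕ} (k : ℕ) (hg : Primrec g) :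
    Primrec fun x => 4 * g x + k :=
  Primrec.nat_add.comp (Primrec.nat_mul.comp (.const 4) hg) (.const k)

theorem primrec₂_pairFormulaCode : Primrec₂ pairFormulaCode := by
  have ha : Primrec fun x : ℕ × ℕ => 2 * (2 * x.1) :=
    Primrec.nat_double.comp (Primrec.nat_double.comp .fst)
  have hb : Primrec fun x : ℕ × ℕ => 2 * (2 * x.2) :=
    Primrec.nat_double.comp (Primrec.nat_double.comp .snd)
  exact Primrec.ite (Primrec.eq.comp .fst .snd)
    (primrec_four_mul_add 1 (Primrec₂.natPair.comp (primrec_succCode.comp ha) ha))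
    (primrec_four_mul_add 3 (Primrec₂.natPair.comp
      (primrec_four_mul_add 1 (Primrec₂.natPair.comp ha hb)) (.const 0)))

theorem primrec₂_notPairsCode : Primrec₂ notPairsCode := by
  have hi : Primrec fun y : ℕ × ℕ × ℕ => y.2.1 := Primrec.fst.comp .snd
  have hstep : Primrec₂ fun (j : ℕ) (y : ℕ × ℕ) =>
      4 * Nat.pair (pairFormulaCode (y.1 / j) (y.1 % j)) y.2 + 3 :=
    primrec_four_mul_add 3 (Primrec₂.natPair.comp
      (primrec₂_pairFormulaCode.comp (Primrec.nat_div.comp hi .fst) (Primrec.nat_mod.comp hi .fst))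
      (Primrec.snd.comp .snd))
  exact Primrec.nat_rec (.const 0) hstep

theorem primrec₂_testFormulaCode : Primrec₂ testFormulaCode :=
  primrec_four_mul_add 3 (Primrec₂.natPair.comp
    (primrec_four_mul_add 3 (Primrec₂.natPair.comp
      (primrec_four_mul_add 2 (Primrec₂.natPair.comp (.const 0)
        (Primrec₂.natPair.comp (Primrec.succ.comp .fst) (.const 0))))
      (primrec₂_notPairsCode.comp .snd (Primrec.nat_mul.comp .snd .snd)))) (.const 0))

variable {A : Type u} [sigU.lang.Structure A]

/-- The interpretation of `s`. -/
def sMapU (a : A) : A :=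
  Language.Structure.funMap ((sigP.inclRight sigS).onFunction symS) fun _ => a

theorem realize_pairFormula {v : ℕ → A} {a b : ℕ} :
    (pairFormula a b).Realize v ↔ if a = b then sMapU (v a) = v a else v a ≠ v b := by
  unfold pairFormula
  split_ifs <;> exact Iff.rfl

/-- A chain of implications ending in falsum negates the conjunction of its premises; this shape
makes the Gödel number a simple primitive recursion. -/
theorem realize_notPairs {v : ℕ → A} {j k : ℕ} :
    (notPairs j k).Realize v ↔ ¬ ∀ i < k, (pairFormula (i / j) (i % j)).Realize v := by
  induction k with
  | zero =>
    refine iff_of_false id fun h => h fun i hi => absurd hi (Nat.not_lt_zero i)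
  | succ k ih =>
    rw [notPairs]
    refine Language.Formula.realize_imp.trans ?_
    rw [ih, Nat.forall_lt_succ_right]
    tauto

theorem realize_testFormula {v : ℕ → A} {n j : ℕ} :
    (testFormula n j).Realize v ↔
      Language.Structure.RelMap ((sigP.inclLeft sigS).onRelation (symP n)) (default : Fin 0 → A) ∧
      (∀ i < j, sMapU (v i) = v i) ∧ ∀ a < j, ∀ b < j, v a = v b → a = b := by
  have h1 : (testFormula n j).Realize v ↔
      ¬ (Language.Structure.RelMap ((sigP.inclLeft sigS).onRelation (symP n))
          (default : Fin 0 → A) → (notPairs j (j * j)).Realize v) := by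
    rw [Subsingleton.elim (default : Fin 0 → A) fun i => (Fin.elim0 i : FreeTerm sigU).val v]
    exact Iff.rfl
  rw [h1, realize_notPairs, Classical.not_imp, not_not]
  refine and_congr_right' ?_
  simp only [realize_pairFormula]
  constructor
  · intro h
    have h' (a b : ℕ) (ha : a < j) (hb : b < j) :
        if a = b then sMapU (v a) = v a else v a ≠ v b := by
      -- The single index j * a + b encodes the pair (a, b).
      have h2 := h (j * a + b) (by nlinarith)
      rwa [Nat.mul_add_div (by omega), Nat.div_eq_of_lt hb, Nat.mul_add_mod,
        Nat.mod_eq_of_lt hb, add_zero] at h2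
    refine ⟨fun i hi => ?_, fun a ha b hb e => ?_⟩
    · simpa using h' i i hi hi
    · by_contra hab
      have := h' a b ha hb
      rw [if_neg hab] at this
      exact this e
  · rintro ⟨h1, h2⟩ i hi
    have hj : 0 < j := Nat.pos_of_ne_zero (by rintro rfl; simp at hi)
    have ha : i / j < j := Nat.div_lt_of_lt_mul hi
    have hb : i % j < j := Nat.mod_lt i hj
    split_ifs with hab
    · exact h1 _ ha
    · exact fun e => hab (h2 _ ha _ hb e)

end Formulas

theorem model_combination_iff {S₁ S₂ : Signature} {T₁ : S₁.lang.Theory} {T₂ : S₂.lang.Theory}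
    {A : Type u} [(S₁.union S₂).lang.Structure A] :
    A ⊨ combination T₁ T₂ ↔
      (letI := (S₁.inclLeft S₂).reduct A; A ⊨ T₁) ∧
      (letI := (S₁.inclRight S₂).reduct A; A ⊨ T₂) := by
  let := (S₁.inclLeft S₂).reduct A
  let := (S₁.inclRight S₂).reduct A
  rw [combination, Language.Theory.model_union_iff]
  exact and_congr (Language.LHom.onTheory_model (S₁.inclLeft S₂) T₁)
    (Language.LHom.onTheory_model (S₁.inclRight S₂) T₂)

theorem mk_eq_of_nat_card {A : Type u} {n : ℕ} (h : Nat.card A = n + 1) :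
    #A = ((n + 1 : ℕ) : Cardinal.{u}) := by
  have : Finite A := Nat.finite_of_card_ne_zero (by omega)
  rw [← h, Nat.cast_card]

/-- A combined interpretation in which `Pₙ₊₁` holds has `f₁(n + 1)` fixed points of `s`. -/
theorem mk_fixed_of_model {f : ℕ → Bool} (hf : Admissible f) {A : Type u} [sigU.lang.Structure A]
    (hA : A ⊨ combination TEq (Tf f)) {n : ℕ}
    (hP : Language.Structure.RelMap ((sigP.inclLeft sigS).onRelation (symP n))
      (default : Fin 0 → A)) :
    #{a : A // sMapU a = a} = count f true (n + 1) := by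
  obtain ⟨h1, h2⟩ := model_combination_iff.1 hA
  let := (sigP.inclLeft sigS).reduct A
  let := (sigP.inclRight sigS).reduct A
  have hn : Nat.card A = n + 1 :=
    model_TEq_iff.1 h1 (n + 1) (Nat.le_add_left 1 n) ((realize_P _).2 hP)
  have hcard := mk_eq_of_nat_card hn
  rw [← mk_fixed_add_mk_nonfixed] at hcard
  -- The size n + 1 determines k as the sum of the two counts, and excludes infinite models.
  rcases (model_Tf_iff hf).1 h2 with ⟨k, -, h3, h4⟩ | ⟨h3, -⟩
  · rw [h3, h4, ← Nat.cast_add, count_add_count] at hcard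
    obtain rfl : k = n + 1 := by exact_mod_cast hcard
    exact h3
  · have := h3.trans ((self_le_add_right _ _).trans hcard.le)
    exact absurd (natCast_lt_aleph0 (n := n + 1)) this.not_gt

/-- Here f(1) = 1 is used: it guarantees a fixed point, to which all non-fixed points can be mapped.
That point accounts for the `- 1` in `X`. -/
theorem exists_model {f : ℕ → Bool} (hf : Admissible f) (n : ℕ) :
    ∃ (A : Type u) (_ : sigU.lang.Structure A), Nonempty A ∧ A ⊨ combination TEq (Tf f) ∧
      Language.Structure.RelMap ((sigP.inclLeft sigS).onRelation (symP n))
        (default : Fin 0 → A) := by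
  let X : Type u := ULift (Fin (count f true (n + 1) - 1))
  let Y : Type u := ULift (Fin (count f false (n + 1)))
  let A : Type u := PUnit.{u + 1} ⊕ X ⊕ Y
  let a : A := .inl ⟨⟩
  let s : A → A := extend id ⟨⟩
  let : sigU.lang.Structure A := uniformStructure sigU a s (· = n + 1)
  have hpos : 1 ≤ count f true (n + 1) := by
    refine le_trans ?_ (count_mono f true (Nat.le_add_left 1 n))
    have := count_succ f true 0
    rw [zero_add, hf.map_one, if_pos rfl] at this
    omega
  have hfix : #{b : A // s b = b} = count f true (n + 1) := by
    refine (mk_fixed_extend _ _).trans ?_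
    have h : #{b : PUnit.{u + 1} // id b = b} = 1 :=
      (Cardinal.mk_congr (Equiv.subtypeUnivEquiv fun _ => rfl)).trans Cardinal.mk_punit
    rw [h, Cardinal.mk_uLift, Cardinal.mk_fin, Cardinal.lift_natCast]
    exact_mod_cast Nat.add_sub_of_le hpos
  have hnonfix : #{b : A // s b ≠ b} = count f false (n + 1) := by
    refine (mk_nonfixed_extend _ _).trans ?_
    have h : #{b : PUnit.{u + 1} // id b ≠ b} = 0 :=
      Cardinal.mk_eq_zero_iff.2 ⟨fun b => b.2 rfl⟩
    rw [h, Cardinal.mk_uLift, Cardinal.mk_fin, Cardinal.lift_natCast, zero_add]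
  have hcard : Nat.card A = n + 1 := by
    have : #A = ((n + 1 : ℕ) : Cardinal.{u}) := by
      rw [← count_add_count f (n + 1), Nat.cast_add, ← hfix, ← hnonfix]
      exact (Cardinal.mk_sum_compl {b : A | s b = b}).symm
    rw [Nat.card, this, Cardinal.toNat_natCast]
  refine ⟨A, inferInstance, ⟨a⟩, model_combination_iff.2 ⟨?_, ?_⟩, rfl⟩
  · let := (sigP.inclLeft sigS).reduct A
    refine model_TEq_iff.2 fun m hm hP => ?_
    rw [realize_P] at hP
    exact hcard.trans (Eq.symm hP)
  · let := (sigP.inclRight sigS).reduct A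
    exact (model_Tf_iff hf).2 (.inl ⟨n + 1, Nat.le_add_left 1 n, hfix, hnonfix⟩)

theorem isSat_testFormula_iff {f : ℕ → Bool} (hf : Admissible f) (n j : ℕ) :
    IsSat.{u} (combination TEq (Tf f)) (testFormula n j) ↔ j ≤ count f true (n + 1) := by
  constructor
  · rintro ⟨A, _, v, hA, h⟩
    obtain ⟨hP, hfix, hinj⟩ := realize_testFormula.1 h
    have hF := mk_fixed_of_model hf hA hP
    obtain ⟨e⟩ := Cardinal.mk_eq_nat_iff.1 hF
    have := Fintype.card_le_of_injective
      (fun i : Fin j => e ⟨v i, hfix i i.2⟩)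
      (fun i i' hi => Fin.ext (hinj i i.2 i' i'.2 (congrArg Subtype.val (e.injective hi))))
    simpa using this
  · intro hj
    obtain ⟨A, _, ⟨a⟩, hA, hP⟩ := exists_model.{u} hf n
    obtain ⟨e⟩ := Cardinal.mk_eq_nat_iff.1 (mk_fixed_of_model hf hA hP)
    let v : ℕ → A := fun i => if h : i < j then (e.symm ⟨i, h.trans_le hj⟩).1 else a
    have hv (i : ℕ) (h : i < j) : v i = (e.symm ⟨i, h.trans_le hj⟩).1 := dif_pos h
    refine ⟨A, inferInstance, v, hA, realize_testFormula.2 ⟨hP, fun i hi => ?_, ?_⟩⟩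
    · rw [hv i hi]
      exact (e.symm ⟨i, hi.trans_le hj⟩).2
    · intro a ha b hb h
      rw [hv a ha, hv b hb] at h
      exact congrArg Fin.val (e.symm.injective (Subtype.ext h))

theorem not_isDecidable_combination {f : ℕ → Bool} (hf : Admissible f) :
    ¬ IsDecidable.{u} (combination TEq (Tf f)) := by
  rintro ⟨_, hdec⟩
  refine hf.not_computable ?_
  obtain ⟨q, hq, hqf⟩ : ∃ q : ℕ → ℕ → Bool, Computable₂ q ∧
      ∀ n j, q n j = true ↔ j ≤ count f true (n + 1) :=
    ⟨_, (hdec.comp (primrec₂_testFormulaCode.to_comp)).to₂, fun n j => by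
      rw [decide_eq_true_iff]
      change (∃ φ : sigU.lang.Formula ℕ, φ.IsQF ∧ _ ∧ formulaCode φ = testFormulaCode n j) ↔ _
      rw [← formulaCode_testFormula, mem_codes_iff (isQF_testFormula n j),
        isSat_testFormula_iff hf]⟩
  -- f(n + 1) = 1 exactly if f₁ increases at n + 1, so one query with j = f₁(n) + 1 reveals it;
  -- iterating computes f₁.
  have hval (n : ℕ) : q n (count f true n + 1) = f (n + 1) := by
    rw [Bool.eq_iff_iff, hqf, count_succ]
    split_ifs with h <;> simp [h]
  have hcount : Computable (count f true) := by
    have hr : Computable fun y : ℕ × ℕ × ℕ => y.2.2 := Computable.snd.comp .snd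
    have hr' : Computable fun y : ℕ × ℕ × ℕ => y.2.2 + 1 := Computable.succ.comp hr
    have hstep : Computable₂ fun (_ : ℕ) (y : ℕ × ℕ) => bif q y.1 (y.2 + 1) then y.2 + 1 else y.2 :=
      Computable.cond (hq.comp (Computable.fst.comp .snd) hr') hr' hr
    refine (Computable.nat_rec Computable.id (Computable.const 0) hstep).of_eq fun n => ?_
    induction n with
    | zero => simp [count]
    | succ n ih =>
      simp only [id] at ih ⊢
      rw [ih, hval, count_succ]
      cases f (n + 1) <;> rfl
  -- The value at 0 is unconstrained and is supplied as a constant.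
  refine (Computable.nat_casesOn Computable.id (Computable.const (f 0))
    (h := fun _ n => q n (count f true n + 1))
    (hq.comp .snd (Computable.succ.comp (hcount.comp .snd))).to₂).of_eq fun n => ?_
  cases n with
  | zero => rfl
  | succ n => exact hval n

theorem isDisjoint_sigP_sigS : sigP.IsDisjoint sigS := fun _ =>
  ⟨Set.empty_inter _, Set.inter_empty _⟩

end TheoryCombination

theorem mainTheorem3 :
    -- decidable theories over disjoint signatures, the second one smooth, with an undecidable
    -- combination
    (∃ (S₁ S₂ : TheoryCombination.Signature) (T₁ : S₁.lang.Theory) (T₂ : S₂.lang.Theory),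
      S₁.IsDisjoint S₂ ∧
      TheoryCombination.IsDecidable.{u} T₁ ∧
      TheoryCombination.IsDecidable.{u} T₂ ∧
      TheoryCombination.IsSmooth.{u} T₂ ∧
      ¬ TheoryCombination.IsDecidable.{u} (TheoryCombination.combination T₁ T₂)) ∧
    -- witnesses: `T_=` and `T_f`, for any admissible function `f`; and such a function exists
    (∃ f : ℕ → Bool, TheoryCombination.Admissible f) ∧
    (∀ f : ℕ → Bool, TheoryCombination.Admissible f →
      TheoryCombination.sigP.IsDisjoint TheoryCombination.sigS ∧
      TheoryCombination.IsDecidable.{u} TheoryCombination.TEq ∧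
      TheoryCombination.IsDecidable.{u} (TheoryCombination.Tf f) ∧
      TheoryCombination.IsSmooth.{u} (TheoryCombination.Tf f) ∧
      ¬ TheoryCombination.IsDecidable.{u}
        (TheoryCombination.combination TheoryCombination.TEq (TheoryCombination.Tf f))) := by
  open TheoryCombination in
  have main (f : ℕ → Bool) (hf : Admissible f) :
      sigP.IsDisjoint sigS ∧ IsDecidable.{u} TEq ∧ IsDecidable.{u} (Tf f) ∧
        IsSmooth.{u} (Tf f) ∧ ¬ IsDecidable.{u} (combination TEq (Tf f)) :=
    ⟨isDisjoint_sigP_sigS, isDecidable_TEq, isDecidable_Tf hf, isSmooth_Tf hf,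
      not_isDecidable_combination hf⟩
  obtain ⟨f, hf⟩ := TheoryCombination.exists_admissible
  exact ⟨⟨_, _, _, _, main f hf⟩, ⟨f, hf⟩, main⟩
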